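/- **Setting.** Let $X$ be a smooth manifold of dimension $n+1$, possibly with boundary, let $\pi : Y \to X$ be a smooth fibration (a surjection with fibred coordinates $(x^\mu, y^i)$ around every point of $Y$) with $m$-dimensional fibres and $\partial Y = \pi^{-1}(\partial X)$, and let $\eta$ be a volume form on $X$. All maps, sections, vector fields and forms are smooth. A $0$-form is called exact if it vanishes. Suppose that $p : W \to X$ is a fibred manifold with $\partial W = p^{-1}(\partial X)$ and that $\Theta$ is an $(n+1)$-form on $W$; put $\Omega = -d\Theta$. Let $B$ be an embedded submanifold of $W$ contained in $\partial W$ (a boundary condition), with inclusion $i_B : B \to W$, and let $\Pi$ be an $n$-form on $B$ with $i_B^*\Theta = d\Pi$. * A vector field $\xi$ on $W$ is a *Cartan symmetry* if $\pounds_\xi\Theta = d\alpha$ for an $n$-form $\alpha$ on $W$ such that $i_B^*\alpha$ is exact on $B$, and if $\xi$ is tangent to $B$ and $\pounds_{\xi|_B}\Pi = 0$. * A section $\sigma : X \to W$ of $p$ *satisfies the field equations of $\Theta$* if $\sigma^*(\iota_\zeta\Omega) = 0$ for every vector field $\zeta$ on $W$. * An $n$-form $\gamma$ on $W$ is a *preserved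 quantity* if $\sigma^* d\gamma = 0$ for every section $\sigma$ of $p$ that satisfies the field equations of $\Theta$. **Lagrangian case.** Let $W = Z = J^1\pi$ be the first jet bundle of $\pi$, with induced coordinates $(x^\mu, y^i, z^i_\mu)$ and projections $\pi_{YZ} : Z \to Y$, $\pi_{XZ} : Z \to X$. The vertical endomorphism $S_\eta$ is the form of degree $n+1$ on $Z$, with values in the tangent vectors of $Z$ that are vertical over $Y$, given at $z = j^1_x\phi$ by $$S_\eta(V_0,\dots,V_n) = \sum_{j=0}^n (-1)^j \bigl(\eta_j\otimes(T\pi_{YZ}(V_j) - T_x\phi\,T\pi_{XZ}(V_j))\bigr)^v ,$$ where $\eta_j(u) = \eta(u, T\pi_{XZ}V_0, \dots, \widehat{T\pi_{XZ}V_j}, \dots, T\pi_{XZ}V_n)$ and, for a linear map $f : T_xX \to \ker T_{\phi(x)}\pi$, $f^v = \frac{d}{dt}\big|_{t=0}(z + tf)$. For a function $L$ on $Z$ the Poincaré–Cartan form is $\Theta_L = L\eta + (S_\eta)^*(dL)$, and $\Omega_L = -d\Theta_L$; in coordinates with $\eta = d^{n+1}x$, $\Theta_L = L\,d^{n+1}x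 + \frac{\partial L}{\partial z^i_\mu}(dy^i - z^i_\nu dx^\nu)\wedge d^nx_\mu$, where $d^nx_\mu = \iota_{\partial/\partial x^\mu}d^{n+1}x$. The field equations of $\Theta_L$ are the De Donder equations. **Hamiltonian case.** Let $\Lambda^{n+1}_rY$ be the bundle of $(n+1)$-forms on $Y$ that vanish when $r$ of their arguments are $\pi$-vertical, let $W = Z^* = \Lambda^{n+1}_2Y/\Lambda^{n+1}_1Y$ be the dual jet bundle, $\mu : \Lambda^{n+1}_2Y \to Z^*$ the natural projection, and $\Theta$ the Liouville form on $\Lambda^{n+1}_2Y$, $\Theta_\omega(V_0,\dots,V_n) = \omega(T\nu V_0,\dots,T\nu V_n)$ with $\nu : \Lambda^{n+1}_2Y \to Y$ the projection. For a Hamiltonian $h$, i.e. a section $h : Z^* \to \Lambda^{n+1}_2Y$ of $\mu$, put $\Theta_h = h^*\Theta$ and $\Omega_h = -d\Theta_h$. The field equations of $\Theta_h$ are the Hamilton equations. **Theorem (Noether).** 1. Let $L$ be a function on $Z$, let $B\subseteq\partial Z$ and $\Pi$ be as above with $i_B^*\Theta_L = d\Pi$, and let $\xi_Z$ be a Cartan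 symmetry with $\pounds_{\xi_Z}\Theta_L = d\alpha$. Then $\iota_{\xi_Z}\Theta_L - \alpha$ is a preserved quantity for the De Donder equations: $\sigma^*d(\iota_{\xi_Z}\Theta_L - \alpha) = 0$ for every section $\sigma$ of $\pi_{XZ}$ with $\sigma^*(\iota_\zeta\Omega_L) = 0$ for all vector fields $\zeta$ on $Z$. Moreover, it is exact on the boundary: $i_B^*(\iota_{\xi_Z}\Theta_L - \alpha)$ is an exact form on $B$. 2. Let $h$ be a Hamiltonian, let $B^*\subseteq\partial Z^*$ and $\Pi^*$ be as above with $i_{B^*}^*\Theta_h = d\Pi^*$, and let $\xi_{Z^*}$ be a Cartan symmetry with $\pounds_{\xi_{Z^*}}\Theta_h = d\alpha$. Then $\sigma^*d(\iota_{\xi_{Z^*}}\Theta_h - \alpha) = 0$ for every section $\sigma : X\to Z^*$ that satisfies the Hamilton equations, and $i_{B^*}^*(\iota_{\xi_{Z^*}}\Theta_h - \alpha)$ is an exact form on $B^*$. -/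

import Mathlib

set_option linter.unusedSectionVars false

open Set
open scoped Manifold ContDiff Topology

noncomputable section

namespace FieldTheory

section Forms

variable {E : Type*} [NormedAddCommGroup E] [NormedSpace ℝ E]
  {H : Type*} [TopologicalSpace H] (I : ModelWithCorners ℝ E H)
  {M : Type*} [TopologicalSpace M] [ChartedSpace H M]
  {E' : Type*} [NormedAddCommGroup E'] [NormedSpace ℝ E']
  {H' : Type*} [TopologicalSpace H'] (I' : ModelWithCorners ℝ E' H')
  {M' : Type*} [TopologicalSpace M'] [ChartedSpace H' M']

/-- The tangent map `T_x f : T_x M → T_{f x} M'`; recall that `TangentSpace I x` is by definition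
the model vector space `E`, and `TangentSpace I' (f x)` is `E'`. -/
def tangentMapAt (f : M → M') (x : M) : E →L[ℝ] E' := mfderiv I I' f x

/-- A (not necessarily smooth) differential `k`-form on `M`: an alternating `k`-linear form on each
tangent space. -/
abbrev DForm (_I : ModelWithCorners ℝ E H) (M : Type*) [TopologicalSpace M] [ChartedSpace H M]
    (k : ℕ) : Type _ := M → E [⋀^Fin k]→L[ℝ] ℝ

/-- A (not necessarily smooth) vector field. -/
abbrev VField (I : ModelWithCorners ℝ E H) (M : Type*) [TopologicalSpace M] [ChartedSpace H M] :
    Type _ := (x : M) → TangentSpace I x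

variable {I I'}

/-- The expression of a form in the preferred (extended) chart around `x₀`, i.e. its pullback by
the inverse of that chart. -/
def DForm.inChart {k : ℕ} (w : DForm I M k) (x₀ : M) (e : E) : E [⋀^Fin k]→L[ℝ] ℝ :=
  (w ((extChartAt I x₀).symm e)).compContinuousLinearMap
    (mfderivWithin 𝓘(ℝ, E) I (extChartAt I x₀).symm (range I) e : E →L[ℝ] E)

/-- The expression of a vector field in the preferred (extended) chart around `x₀`. -/
def VField.inChart (ξ : VField I M) (x₀ : M) (e : E) : E :=
  tangentMapAt I 𝓘(ℝ, E) (extChartAt I x₀) ((extChartAt I x₀).symm e)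
    (ξ ((extChartAt I x₀).symm e))

/-- Smooth differential forms. -/
def DForm.IsSmooth {k : ℕ} (w : DForm I M k) : Prop :=
  ∀ x₀ : M, ContDiffOn ℝ ∞ (w.inChart x₀) (extChartAt I x₀).target

/-- Smooth vector fields. -/
def VField.IsSmooth [IsManifold I 1 M] (ξ : VField I M) : Prop :=
  ContMDiff I I.tangent ∞ (fun x => (⟨x, ξ x⟩ : TangentBundle I M))

/-- The exterior derivative. -/
def DForm.d {k : ℕ} (w : DForm I M k) : DForm I M (k + 1) := fun x =>
  (extDerivWithin (w.inChart x) (range I) (extChartAt I x x)).compContinuousLinearMap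
    (tangentMapAt I 𝓘(ℝ, E) (extChartAt I x) x)

/-- The interior product `ι_ξ w = w (ξ, ·, …, ·)`. -/
def DForm.interior {k : ℕ} (ξ : VField I M) (w : DForm I M (k + 1)) : DForm I M k := fun x =>
  (w x).curryLeft (ξ x : E)

/-- The pullback `f^* w`. -/
def DForm.pullback {k : ℕ} (f : M → M') (w : DForm I' M' k) : DForm I M k := fun x =>
  (w (f x)).compContinuousLinearMap (tangentMapAt I I' f x)

/-- The infinitesimal action of an endomorphism `A` on an alternating form,
`(v₁, …, v_k) ↦ ∑ i, w (v₁, …, A v_i, …, v_k)`. -/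
def altDerivation {k : ℕ} (A : E →L[ℝ] E) (w : E [⋀^Fin k]→L[ℝ] ℝ) : E [⋀^Fin k]→L[ℝ] ℝ where
  toFun v := ∑ i, w (Function.update v i (A (v i)))
  map_update_add' := by
    intro inst v j x y
    obtain rfl : inst = instDecidableEqFin k := Subsingleton.elim _ _
    rw [← Finset.sum_add_distrib]
    refine Finset.sum_congr rfl fun i _ => ?_
    by_cases h : i = j
    · subst h; simp
    · rw [Function.update_of_ne h, Function.update_of_ne h, Function.update_of_ne h]
      rw [Function.update_comm (Ne.symm h), Function.update_comm (Ne.symm h),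
        Function.update_comm (Ne.symm h), w.map_update_add]
  map_update_smul' := by
    intro inst v j c x
    obtain rfl : inst = instDecidableEqFin k := Subsingleton.elim _ _
    rw [Finset.smul_sum]
    refine Finset.sum_congr rfl fun i _ => ?_
    by_cases h : i = j
    · subst h; simp
    · rw [Function.update_of_ne h, Function.update_of_ne h]
      rw [Function.update_comm (Ne.symm h), Function.update_comm (Ne.symm h), w.map_update_smul]
  map_eq_zero_of_eq' := by
    classical
    intro v i j hv hij
    have key : ∀ l, l ≠ i → l ≠ j → w (Function.update v l (A (v l))) = 0 := by
      intro l hi hj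
      refine w.map_eq_zero_of_eq _ (i := i) (j := j) ?_ hij
      rw [Function.update_of_ne hi.symm, Function.update_of_ne hj.symm, hv]
    have h1 : (∑ l, w (Function.update v l (A (v l)))) =
        ∑ l ∈ {i, j}, w (Function.update v l (A (v l))) := by
      symm
      refine Finset.sum_subset (Finset.subset_univ _) fun l _ hl => ?_
      simp only [Finset.mem_insert, Finset.mem_singleton, not_or] at hl
      exact key l hl.1 hl.2
    show (∑ l, w (Function.update v l (A (v l)))) = 0
    rw [h1, Finset.sum_pair hij]
    have h2 := w.map_swap (Function.update v i (A (v i))) hij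
    have h3 : Function.update v i (A (v i)) ∘ Equiv.swap i j = Function.update v j (A (v j)) := by
      funext l
      by_cases hl : l = i
      · subst hl
        simp [Function.update_of_ne hij.symm, Function.update_of_ne hij, hv]
      · by_cases hl' : l = j
        · subst hl'; simp [hv]
        · simp [Equiv.swap_apply_of_ne_of_ne hl hl', Function.update_of_ne hl,
            Function.update_of_ne hl']
    rw [h3] at h2
    exact add_eq_zero_iff_eq_neg'.mpr h2
  cont := by
    refine continuous_finsetSum _ fun i _ => w.cont.comp ?_
    exact continuous_id.update i (A.continuous.comp (continuous_apply i))

/-- The Lie derivative `£_ξ w`, by its expression in coordinates: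
`(£_ξ w)(v₁, …, v_k) = (D w · ξ)(v₁, …, v_k) + ∑ i, w (v₁, …, D ξ · v_i, …, v_k)`. -/
def DForm.lieDeriv {k : ℕ} (ξ : VField I M) (w : DForm I M k) : DForm I M k := fun x =>
  (fderivWithin ℝ (w.inChart x) (range I) (extChartAt I x x) (ξ.inChart x (extChartAt I x x)) +
    altDerivation (fderivWithin ℝ (ξ.inChart x) (range I) (extChartAt I x x))
      (w.inChart x (extChartAt I x x))).compContinuousLinearMap
    (tangentMapAt I 𝓘(ℝ, E) (extChartAt I x) x)

/-- Exact forms. A `0`-form is exact only if it vanishes, as there are no forms of degree `-1`. -/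
def DForm.IsExact : {k : ℕ} → DForm I M k → Prop
  | 0, w => w = 0
  | _ + 1, w => ∃ β : DForm I M _, β.IsSmooth ∧ β.d = w

end Forms

section Total

variable {E : Type*} [NormedAddCommGroup E] [NormedSpace ℝ E]
  {H : Type*} [TopologicalSpace H] {I : ModelWithCorners ℝ E H}
  {M : Type*} [TopologicalSpace M] [ChartedSpace H M]
  {G : Type*} [NormedAddCommGroup G] [NormedSpace ℝ G]
  {Fib : M → Type*} {ι : Type*}

/-- The data that turn a family of fibres `Fib x`, `x : M`, into a smooth locally trivial bundle
with typical fibre the vector space `G`: charts `base i` of `M`, over each of which the fibres are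
identified with `G`, with smooth changes of coordinates. -/
structure FibreCharts (I : ModelWithCorners ℝ E H) (G : Type*) [NormedAddCommGroup G]
    [NormedSpace ℝ G] (Fib : M → Type*) (ι : Type*) where
  base : ι → OpenPartialHomeomorph M H
  base_mem : ∀ i, base i ∈ IsManifold.maximalAtlas I ∞ M
  idx : M → ι
  mem_idx : ∀ x, x ∈ (base (idx x)).source
  triv : ∀ i x, x ∈ (base i).source → (Fib x ≃ G)
  change : ι → ι → E × G → G
  change_smooth : ∀ i j, ContDiffOn ℝ ∞ (change i j)
    ((I.symm ⁻¹' ((base i).symm.trans (base j)).source ∩ range I) ×ˢ univ)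
  change_eq : ∀ i j x (hi : x ∈ (base i).source) (hj : x ∈ (base j).source) (f : Fib x),
    triv j x hj f = change i j (I (base i x), triv i x hi f)

/-- The total space of the bundle described by `c`. -/
structure Total (c : FibreCharts I G Fib ι) where
  pt : M
  fib : Fib pt

namespace FibreCharts

variable (c : FibreCharts I G Fib ι)

open Classical in
/-- The inverse of the identification of a fibre with `G` (with a junk value off the domain). -/
def inv (i : ι) (x : M) (g : G) : Fib x :=
  if h : x ∈ (c.base i).source then (c.triv i x h).symm g
  else (c.triv (c.idx x) x (c.mem_idx x)).symm 0

open Classical in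
/-- The identification of a fibre with `G` (with a junk value off the domain). -/
def coord (i : ι) (z : Total c) : G :=
  if h : z.pt ∈ (c.base i).source then c.triv i z.pt h z.fib else 0

theorem coord_of_mem (i : ι) (z : Total c) (h : z.pt ∈ (c.base i).source) :
    c.coord i z = c.triv i z.pt h z.fib := dif_pos h

theorem inv_of_mem (i : ι) (x : M) (g : G) (h : x ∈ (c.base i).source) :
    c.inv i x g = (c.triv i x h).symm g := dif_pos h

theorem mk_inv_eq (i : ι) (z : Total c) (h : z.pt ∈ (c.base i).source) :
    ∀ x, x = z.pt → (⟨x, c.inv i x (c.coord i z)⟩ : Total c) = z := by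
  rintro _ rfl
  rw [inv_of_mem c i _ _ h, coord_of_mem c i z h, Equiv.symm_apply_apply]

/-- The chart of the total space induced by a chart of the base, as a partial bijection:
`(x, f) ↦ (base i x, triv i x f)`. -/
def chart (i : ι) : PartialEquiv (Total c) (ModelProd H G) where
  toFun z := (c.base i z.pt, c.coord i z)
  invFun p := ⟨(c.base i).symm p.1, c.inv i _ p.2⟩
  source := {z | z.pt ∈ (c.base i).source}
  target := (c.base i).target ×ˢ univ
  map_source' z hz := ⟨(c.base i).map_source hz, mem_univ _⟩
  map_target' p hp := (c.base i).map_target hp.1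
  left_inv' z hz := c.mk_inv_eq i z hz _ ((c.base i).left_inv hz)
  right_inv' p hp := by
    have h := (c.base i).map_target hp.1
    refine Prod.ext ((c.base i).right_inv hp.1) ?_
    change c.coord i ⟨(c.base i).symm p.1, c.inv i _ p.2⟩ = p.2
    rw [coord_of_mem c i _ h]
    change c.triv i _ h (c.inv i _ p.2) = p.2
    rw [inv_of_mem c i _ _ h, Equiv.apply_symm_apply]

theorem mem_trans_source (i j : ι) (p : H) :
    p ∈ ((c.base i).symm.trans (c.base j)).source ↔
      p ∈ (c.base i).target ∧ (c.base i).symm p ∈ (c.base j).source := by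
  simp

theorem chart_trans_source (i j : ι) : ((c.chart i).symm.trans (c.chart j)).source =
    ((c.base i).symm.trans (c.base j)).source ×ˢ univ := by
  ext p
  rw [PartialEquiv.trans_source, PartialEquiv.symm_source]
  have h := c.mem_trans_source i j p.1
  exact ⟨fun hp => ⟨h.2 ⟨hp.1.1, hp.2⟩, mem_univ _⟩,
    fun hp => ⟨⟨(h.1 hp.1).1, mem_univ _⟩, (h.1 hp.1).2⟩⟩

theorem chart_trans_apply (i j : ι) (p : ModelProd H G)
    (hp : p ∈ ((c.base i).symm.trans (c.base j)).source ×ˢ (univ : Set G)) :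
    (c.chart i).symm.trans (c.chart j) p =
      ((c.base i).symm.trans (c.base j) p.1, c.change i j (I p.1, p.2)) := by
  obtain ⟨h1, h2⟩ := (c.mem_trans_source i j p.1).1 hp.1
  have hi := (c.base i).map_target h1
  refine Prod.ext rfl ?_
  change c.coord j ⟨(c.base i).symm p.1, c.inv i _ p.2⟩ = c.change i j (I p.1, p.2)
  rw [coord_of_mem c j ⟨(c.base i).symm p.1, c.inv i _ p.2⟩ h2, c.change_eq i j _ hi h2]
  change c.change i j (I (c.base i ((c.base i).symm p.1)), c.triv i _ hi (c.inv i _ p.2)) = _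
  rw [inv_of_mem c i _ _ hi, Equiv.apply_symm_apply, (c.base i).right_inv h1]

/-- The induced charts turn the total space into a charted space. -/
def core : ChartedSpaceCore (ModelProd H G) (Total c) where
  atlas := range c.chart
  chartAt z := c.chart (c.idx z.pt)
  mem_chart_source z := c.mem_idx z.pt
  chart_mem_atlas z := mem_range_self _
  open_source := by
    rintro _ _ ⟨i, rfl⟩ ⟨j, rfl⟩
    rw [chart_trans_source]
    exact ((c.base i).symm.trans (c.base j)).open_source.prod isOpen_univ
  continuousOn_toFun := by
    rintro _ _ ⟨i, rfl⟩ ⟨j, rfl⟩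
    rw [chart_trans_source]
    refine ContinuousOn.congr ?_ (fun p hp => c.chart_trans_apply i j p hp)
    refine ContinuousOn.prodMk ?_ ?_
    · exact ((c.base i).symm.trans (c.base j)).continuousOn.comp continuousOn_fst fun p hp => hp.1
    · refine (c.change_smooth i j).continuousOn.comp
        ((I.continuous.comp continuous_fst).prodMk continuous_snd).continuousOn fun p hp => ?_
      refine ⟨⟨?_, mem_range_self _⟩, mem_univ _⟩
      change I.symm (I p.1) ∈ ((c.base i).symm.trans (c.base j)).source
      rw [I.left_inv]
      exact hp.1

end FibreCharts

namespace Total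

variable (c : FibreCharts I G Fib ι)

instance : TopologicalSpace (Total c) := c.core.toTopologicalSpace

instance : ChartedSpace (ModelProd H G) (Total c) := c.core.toChartedSpace

instance [IsManifold I ∞ M] : IsManifold (I.prod 𝓘(ℝ, G)) ∞ (Total c) := by
  refine isManifold_of_contDiffOn _ _ _ fun e e' he he' => ?_
  obtain ⟨_, ⟨_, rfl⟩, _, ⟨⟨i, rfl⟩, rfl⟩, rfl⟩ := he
  obtain ⟨_, ⟨_, rfl⟩, _, ⟨⟨j, rfl⟩, rfl⟩, rfl⟩ := he'
  change ContDiffOn ℝ ∞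
    (I.prod 𝓘(ℝ, G) ∘ (c.chart i).symm.trans (c.chart j) ∘ (I.prod 𝓘(ℝ, G)).symm)
      ((I.prod 𝓘(ℝ, G)).symm ⁻¹' ((c.chart i).symm.trans (c.chart j)).source ∩
        range (I.prod 𝓘(ℝ, G)))
  have hset : ((I.prod 𝓘(ℝ, G)).symm ⁻¹' ((c.chart i).symm.trans (c.chart j)).source ∩
        range (I.prod 𝓘(ℝ, G))) =
      (I.symm ⁻¹' ((c.base i).symm.trans (c.base j)).source ∩ range I) ×ˢ (univ : Set G) := by
    rw [c.chart_trans_source, ModelWithCorners.range_prod]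
    ext q
    constructor
    · exact fun h => ⟨⟨h.1.1, h.2.1⟩, mem_univ _⟩
    · exact fun h => ⟨⟨h.1.1, mem_univ _⟩, ⟨h.1.2, mem_range_self (f := 𝓘(ℝ, G)) q.2⟩⟩
  have h1 : ContDiffOn ℝ ∞ (I ∘ (c.base i).symm.trans (c.base j) ∘ I.symm)
      (I.symm ⁻¹' ((c.base i).symm.trans (c.base j)).source ∩ range I) := by
    have h := IsManifold.compatible_of_mem_maximalAtlas (c.base_mem i) (c.base_mem j)
    rw [contDiffGroupoid, mem_groupoid_of_pregroupoid] at h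
    exact h.1
  rw [hset]
  have h2 := (h1.comp (contDiff_fst (E := E) (F := G)).contDiffOn
    (fun q hq => hq.1)).prodMk (c.change_smooth i j)
  refine h2.congr fun q hq => ?_
  have h3 := c.chart_trans_apply i j (I.symm q.1, q.2) ⟨hq.1.1, mem_univ _⟩
  change I.prod 𝓘(ℝ, G) ((c.chart i).symm.trans (c.chart j) (I.symm q.1, q.2)) = _
  rw [h3, I.right_inv hq.1.2]
  rfl

/-- The first projection of the model space is smooth. -/
theorem _root_.FieldTheory.contMDiff_fst_model {F : Type*} [NormedAddCommGroup F] [NormedSpace ℝ F] :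
    ContMDiff (M := ModelProd H F) (I.prod 𝓘(ℝ, F)) I ∞ Prod.fst := by
  have h : ContMDiff (M := H × F) (I.prod 𝓘(ℝ, F)) I ∞ Prod.fst := contMDiff_fst
  rw [chartedSpaceSelf_prod] at h
  exact h

theorem chartAt_apply (z z' : Total c) :
    chartAt (ModelProd H G) z z' = (c.base (c.idx z.pt) z'.pt, c.coord (c.idx z.pt) z') := rfl

/-- The bundle projection is smooth. -/
theorem contMDiff_pt [IsManifold I ∞ M] :
    ContMDiff (I.prod 𝓘(ℝ, G)) I ∞ (Total.pt : Total c → M) := by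
  intro z
  have h1 : ContMDiffAt (I.prod 𝓘(ℝ, G)) (I.prod 𝓘(ℝ, G)) ∞ (chartAt (ModelProd H G) z) z :=
    contMDiffAt_of_mem_maximalAtlas (IsManifold.chart_mem_maximalAtlas z)
      (mem_chart_source _ z)
  have h2 : ContMDiffAt (I.prod 𝓘(ℝ, G)) I ∞
      (fun z' => (chartAt (ModelProd H G) z z').1) z :=
    (contMDiff_fst_model _).comp z h1
  have h3 : ContMDiffAt I I ∞ (c.base (c.idx z.pt)).symm (c.base (c.idx z.pt) z.pt) :=
    contMDiffAt_symm_of_mem_maximalAtlas (c.base_mem _)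
      ((c.base (c.idx z.pt)).map_source (c.mem_idx _))
  have h4 := ContMDiffAt.comp z (g := (c.base (c.idx z.pt)).symm) h3 h2
  refine h4.congr_of_eventuallyEq ?_
  filter_upwards [(chartAt (ModelProd H G) z).open_source.mem_nhds (mem_chart_source _ z)]
    with z' hz'
  exact ((c.base (c.idx z.pt)).left_inv hz').symm

end Total
end Total

section Jacobian

variable {E : Type*} [NormedAddCommGroup E] [NormedSpace ℝ E]
  {H : Type*} [TopologicalSpace H] (I : ModelWithCorners ℝ E H)
  {M : Type*} [TopologicalSpace M] [ChartedSpace H M]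

/-- The change of coordinates between two charts, written in the model vector space. -/
def transition (e e' : OpenPartialHomeomorph M H) : E → E := I ∘ e.symm.trans e' ∘ I.symm

/-- The derivative of a change of coordinates. -/
def jac (e e' : OpenPartialHomeomorph M H) (q : E) : E →L[ℝ] E :=
  fderivWithin ℝ (transition I e e') (range I) q

/-- The coordinate domain of a change of coordinates. -/
def overlap (e e' : OpenPartialHomeomorph M H) : Set E :=
  I.symm ⁻¹' (e.symm.trans e').source ∩ range I

variable {I}

theorem contDiffOn_transition [IsManifold I ∞ M] {e e' : OpenPartialHomeomorph M H}
    (he : e ∈ IsManifold.maximalAtlas I ∞ M) (he' : e' ∈ IsManifold.maximalAtlas I ∞ M) :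
    ContDiffOn ℝ ∞ (transition I e e') (overlap I e e') := by
  have h := IsManifold.compatible_of_mem_maximalAtlas he he'
  rw [contDiffGroupoid, mem_groupoid_of_pregroupoid] at h
  exact h.1

theorem contDiffOn_jac [IsManifold I ∞ M] {e e' : OpenPartialHomeomorph M H}
    (he : e ∈ IsManifold.maximalAtlas I ∞ M) (he' : e' ∈ IsManifold.maximalAtlas I ∞ M) :
    ContDiffOn ℝ ∞ (jac I e e') (overlap I e e') := by
  have h := contDiffOn_transition he he'
  have ho : IsOpen (I.symm ⁻¹' (e.symm.trans e').source) :=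
    (e.symm.trans e').open_source.preimage I.continuous_symm
  have hu : UniqueDiffOn ℝ (overlap I e e') := by
    rw [overlap, inter_comm]
    exact I.uniqueDiffOn.inter ho
  refine (h.fderivWithin hu (m := ∞) (by norm_num)).congr fun q hq => ?_
  rw [jac, overlap, inter_comm, fderivWithin_inter (ho.mem_nhds hq.1)]

theorem mem_overlap {e e' : OpenPartialHomeomorph M H} {x : M} (hx : x ∈ e.source)
    (hx' : x ∈ e'.source) : I (e x) ∈ overlap I e e' := by
  refine ⟨?_, mem_range_self _⟩
  rw [mem_preimage, I.left_inv]
  simp [hx, hx', e.map_source hx]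

theorem transition_apply {e e' : OpenPartialHomeomorph M H} {x : M} (hx : x ∈ e.source) :
    transition I e e' (I (e x)) = I (e' x) := by
  simp [transition, hx]

theorem jac_comp [IsManifold I ∞ M] {e e' : OpenPartialHomeomorph M H}
    (he : e ∈ IsManifold.maximalAtlas I ∞ M) (he' : e' ∈ IsManifold.maximalAtlas I ∞ M) {x : M}
    (hx : x ∈ e.source) (hx' : x ∈ e'.source) (v : E) :
    jac I e e' (I (e x)) (tangentMapAt I I e x v) = tangentMapAt I I e' x v := by
  have h0 : e x ∈ (e.symm.trans e').source := by simp [hx, hx', e.map_source hx]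
  have h1 : MDifferentiableAt I I (e.symm.trans e') (e x) := by
    have ha := (contMDiffAt_symm_of_mem_maximalAtlas he (e.map_source hx)).mdifferentiableAt
      (by norm_num)
    have hb : MDifferentiableAt I I e' (e.symm (e x)) := by
      rw [e.left_inv hx]
      exact (contMDiffAt_of_mem_maximalAtlas he' hx').mdifferentiableAt (by norm_num)
    exact hb.comp _ ha
  have h2 : MDifferentiableAt I I e x :=
    (contMDiffAt_of_mem_maximalAtlas he hx).mdifferentiableAt (by norm_num)
  have h3 : mfderiv I I e' x = (mfderiv I I (e.symm.trans e') (e x)).comp (mfderiv I I e x) := by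
    rw [← mfderiv_comp x h1 h2]
    refine Filter.EventuallyEq.mfderiv_eq ?_
    filter_upwards [e.open_source.mem_nhds hx] with x' h'
    simp [h']
  have h4 : (mfderiv I I (e.symm.trans e') (e x) : E →L[ℝ] E) = jac I e e' (I (e x)) := by
    exact h1.mfderiv
  rw [← h4]
  exact (DFunLike.congr_fun h3 v).symm

theorem tangentMapAt_symm_chart {e : OpenPartialHomeomorph M H} [IsManifold I ∞ M]
    (he : e ∈ IsManifold.maximalAtlas I ∞ M) {x : M} (hx : x ∈ e.source) (v : E) :
    tangentMapAt I I e.symm (e x) (tangentMapAt I I e x v) = v := by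
  have hd : e.MDifferentiable I I :=
    ⟨(contMDiffOn_of_mem_maximalAtlas he).mdifferentiableOn (by norm_num),
      (contMDiffOn_symm_of_mem_maximalAtlas he).mdifferentiableOn (by norm_num)⟩
  exact DFunLike.congr_fun (hd.symm_comp_deriv hx) v

theorem tangentMapAt_chart_symm {e : OpenPartialHomeomorph M H} [IsManifold I ∞ M]
    (he : e ∈ IsManifold.maximalAtlas I ∞ M) {x : M} (hx : x ∈ e.source) (v : E) :
    tangentMapAt I I e x (tangentMapAt I I e.symm (e x) v) = v := by
  have hd : e.MDifferentiable I I :=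
    ⟨(contMDiffOn_of_mem_maximalAtlas he).mdifferentiableOn (by norm_num),
      (contMDiffOn_symm_of_mem_maximalAtlas he).mdifferentiableOn (by norm_num)⟩
  have h := DFunLike.congr_fun (hd.comp_symm_deriv (e.map_source hx)) v
  rw [e.left_inv hx] at h
  exact h

end Jacobian

section Fibration

variable {E : Type*} [NormedAddCommGroup E] [NormedSpace ℝ E]
  {H : Type*} [TopologicalSpace H] {I : ModelWithCorners ℝ E H}
  {F : Type*} [NormedAddCommGroup F] [NormedSpace ℝ F]
  {X : Type*} [TopologicalSpace X] [ChartedSpace H X]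
  {Y : Type*} [TopologicalSpace Y] [ChartedSpace (ModelProd H F) Y]

theorem hasMFDerivAt_fst_model (p : ModelProd H F) :
    HasMFDerivAt (M := ModelProd H F) (I.prod 𝓘(ℝ, F)) I Prod.fst p
      (ContinuousLinearMap.fst ℝ E F) := by
  have h : HasMFDerivAt (M := H × F) (I.prod 𝓘(ℝ, F)) I Prod.fst p
      (ContinuousLinearMap.fst ℝ E F) := hasMFDerivAt_fst p
  rw [chartedSpaceSelf_prod] at h
  exact h

/-- Charts `e` of `Y` and `φ` of `X` are adapted to `π : Y → X` if, in the corresponding fibred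
coordinates, `π (x, y) = x`. -/
structure IsAdapted (I : ModelWithCorners ℝ E H) (π : Y → X)
    (e : OpenPartialHomeomorph Y (ModelProd H F)) (φ : OpenPartialHomeomorph X H) : Prop where
  mem_total : e ∈ IsManifold.maximalAtlas (I.prod 𝓘(ℝ, F)) ∞ Y
  mem_base : φ ∈ IsManifold.maximalAtlas I ∞ X
  mapsTo : ∀ y ∈ e.source, π y ∈ φ.source
  fst_eq : ∀ y ∈ e.source, (e y).1 = φ (π y)

/-- A fibration `π : Y → X`: a surjection around every point of which there are fibred
coordinates. `X` may have a boundary; since `Y` is modelled on `I.prod 𝓘(ℝ, F)`, its boundary is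
the preimage of that of `X`. -/
structure Fibration (I : ModelWithCorners ℝ E H) (F : Type*) [NormedAddCommGroup F]
    [NormedSpace ℝ F] (X : Type*) [TopologicalSpace X] [ChartedSpace H X]
    (Y : Type*) [TopologicalSpace Y] [ChartedSpace (ModelProd H F) Y] where
  proj : Y → X
  surjective : Function.Surjective proj
  exists_adapted : ∀ y : Y, ∃ e φ, IsAdapted (F := F) I proj e φ ∧ y ∈ e.source

namespace Fibration

variable (π : Fibration I F X Y)

/-- Pairs of adapted charts. -/
def AdaptedCharts : Type _ :=
  {i : OpenPartialHomeomorph Y (ModelProd H F) × OpenPartialHomeomorph X H //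
    IsAdapted I π.proj i.1 i.2}

/-- A choice of adapted charts around a point. -/
def adaptedAt (y : Y) : π.AdaptedCharts :=
  ⟨((π.exists_adapted y).choose, (π.exists_adapted y).choose_spec.choose),
    (π.exists_adapted y).choose_spec.choose_spec.1⟩

theorem mem_adaptedAt (y : Y) : y ∈ (π.adaptedAt y).1.1.source :=
  (π.exists_adapted y).choose_spec.choose_spec.2

/-- The tangent map `T_y π`. -/
def tangentProj (y : Y) : E × F →L[ℝ] E := tangentMapAt (I.prod 𝓘(ℝ, F)) I π.proj y

/-- The vertical subspace `V_y π = ker T_y π`. -/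
def vertical (y : Y) : Submodule ℝ (E × F) := LinearMap.ker (π.tangentProj y).toLinearMap

variable {π}

theorem contMDiffAt_proj [IsManifold I ∞ X] [IsManifold (I.prod 𝓘(ℝ, F)) ∞ Y] (y : Y) :
    ContMDiffAt (I.prod 𝓘(ℝ, F)) I ∞ π.proj y := by
  obtain ⟨e, φ, h, hy⟩ := π.exists_adapted y
  have h1 := (contMDiff_fst_model (F := F) (I := I) _).comp y
    (contMDiffAt_of_mem_maximalAtlas h.mem_total hy)
  have h2 : ContMDiffAt I I ∞ φ.symm (e y).1 :=
    contMDiffAt_symm_of_mem_maximalAtlas h.mem_base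
      (by rw [h.fst_eq y hy]; exact φ.map_source (h.mapsTo y hy))
  refine (ContMDiffAt.comp y (g := φ.symm) h2 h1).congr_of_eventuallyEq ?_
  filter_upwards [e.open_source.mem_nhds hy] with y' hy'
  change π.proj y' = φ.symm (e y').1
  rw [h.fst_eq y' hy', φ.left_inv (h.mapsTo y' hy')]

theorem fst_tangentMapAt [IsManifold I ∞ X] [IsManifold (I.prod 𝓘(ℝ, F)) ∞ Y]
    (i : π.AdaptedCharts) {y : Y} (hy : y ∈ i.1.1.source) (v : E × F) :
    (tangentMapAt (I.prod 𝓘(ℝ, F)) (I.prod 𝓘(ℝ, F)) i.1.1 y v).1 =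
      tangentMapAt I I i.1.2 (π.proj y) (π.tangentProj y v) := by
  have h := i.2
  have h1 := ((contMDiffAt_of_mem_maximalAtlas h.mem_total hy).mdifferentiableAt
    (by norm_num)).hasMFDerivAt
  have h2 := (hasMFDerivAt_fst_model (I := I) (F := F) (i.1.1 y)).comp y h1
  have h3 := ((contMDiffAt_proj (π := π) y).mdifferentiableAt (by norm_num)).hasMFDerivAt
  have h4 := ((contMDiffAt_of_mem_maximalAtlas h.mem_base (h.mapsTo y hy)).mdifferentiableAt
    (by norm_num)).hasMFDerivAt
  have h5 := (h4.comp y h3).congr_of_eventuallyEq (f₁ := Prod.fst ∘ i.1.1)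
    (by filter_upwards [i.1.1.open_source.mem_nhds hy] with y' hy'
        exact h.fst_eq y' hy')
  exact DFunLike.congr_fun (hasMFDerivAt_unique h2 h5) v

end Fibration
end Fibration

section JetBundle

variable {E : Type*} [NormedAddCommGroup E] [NormedSpace ℝ E]
  {H : Type*} [TopologicalSpace H] {I : ModelWithCorners ℝ E H}
  {F : Type*} [NormedAddCommGroup F] [NormedSpace ℝ F]
  {X : Type*} [TopologicalSpace X] [ChartedSpace H X]
  {Y : Type*} [TopologicalSpace Y] [ChartedSpace (ModelProd H F) Y]

namespace Fibration

variable (π : Fibration I F X Y)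

/-- The fibre of the first jet bundle over `y`: the linear sections `T_x X → T_y Y` of `T_y π`,
`x = π y` (a jet `j¹_x φ` with `φ x = y` corresponds to `T_x φ`). -/
def JetFibre (y : Y) : Type _ :=
  {s : E →L[ℝ] E × F // (π.tangentProj y).comp s = ContinuousLinearMap.id ℝ E}

variable [IsManifold I ∞ X] [IsManifold (I.prod 𝓘(ℝ, F)) ∞ Y]

/-- The coordinates `z^i_μ` on the fibres of the jet bundle induced by fibred coordinates. -/
def jetTriv (i : π.AdaptedCharts) (y : Y) (hy : y ∈ i.1.1.source) :
    π.JetFibre y ≃ (E →L[ℝ] F) where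
  toFun s := (ContinuousLinearMap.snd ℝ E F).comp
    ((tangentMapAt (I.prod 𝓘(ℝ, F)) (I.prod 𝓘(ℝ, F)) i.1.1 y).comp
      (s.1.comp (tangentMapAt I I i.1.2.symm (i.1.2 (π.proj y)))))
  invFun A := ⟨(tangentMapAt (I.prod 𝓘(ℝ, F)) (I.prod 𝓘(ℝ, F)) i.1.1.symm (i.1.1 y)).comp
      ((ContinuousLinearMap.inl ℝ E F + (ContinuousLinearMap.inr ℝ E F).comp A).comp
        (tangentMapAt I I i.1.2 (π.proj y))), by
    ext v
    have h1 := fst_tangentMapAt i hy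
      (tangentMapAt (I.prod 𝓘(ℝ, F)) (I.prod 𝓘(ℝ, F)) i.1.1.symm (i.1.1 y)
        ((ContinuousLinearMap.inl ℝ E F + (ContinuousLinearMap.inr ℝ E F).comp A)
          (tangentMapAt I I i.1.2 (π.proj y) v)))
    rw [tangentMapAt_chart_symm i.2.mem_total hy] at h1
    have h2 := congrArg (tangentMapAt I I i.1.2.symm (i.1.2 (π.proj y))) h1
    rw [tangentMapAt_symm_chart i.2.mem_base (i.2.mapsTo y hy)] at h2
    rw [ContinuousLinearMap.comp_apply, ContinuousLinearMap.comp_apply,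
      ContinuousLinearMap.comp_apply, ← h2]
    simp [tangentMapAt_symm_chart i.2.mem_base (i.2.mapsTo y hy)]⟩
  left_inv s := by
    refine Subtype.ext (ContinuousLinearMap.ext fun v => ?_)
    have h1 := fst_tangentMapAt i hy (s.1 v)
    have h2 : π.tangentProj y (s.1 v) = v := DFunLike.congr_fun s.2 v
    rw [h2] at h1
    simp only [ContinuousLinearMap.comp_apply, add_apply,
      tangentMapAt_symm_chart i.2.mem_base (i.2.mapsTo y hy)]
    rw [← h1]
    simp [tangentMapAt_symm_chart i.2.mem_total hy]
  right_inv A := by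
    ext v
    simp only [ContinuousLinearMap.comp_apply,
      tangentMapAt_chart_symm i.2.mem_base (i.2.mapsTo y hy),
      tangentMapAt_chart_symm i.2.mem_total hy]
    simp

theorem jetTriv_apply (i : π.AdaptedCharts) (y : Y) (hy : y ∈ i.1.1.source) (s : π.JetFibre y)
    (v : E) : π.jetTriv i y hy s (tangentMapAt I I i.1.2 (π.proj y) v) =
      (tangentMapAt (I.prod 𝓘(ℝ, F)) (I.prod 𝓘(ℝ, F)) i.1.1 y (s.1 v)).2 := by
  change (tangentMapAt (I.prod 𝓘(ℝ, F)) (I.prod 𝓘(ℝ, F)) i.1.1 y (s.1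
    (tangentMapAt I I i.1.2.symm (i.1.2 (π.proj y))
      (tangentMapAt I I i.1.2 (π.proj y) v)))).2 = _
  rw [tangentMapAt_symm_chart i.2.mem_base (i.2.mapsTo y hy)]

/-- The smooth structure of the first jet bundle, given by the induced coordinates
`(x^μ, y^i, z^i_μ)`. -/
def jetCharts : FibreCharts (I.prod 𝓘(ℝ, F)) (E →L[ℝ] F) π.JetFibre π.AdaptedCharts where
  base i := i.1.1
  base_mem i := i.2.mem_total
  idx := π.adaptedAt
  mem_idx := π.mem_adaptedAt
  triv := π.jetTriv
  change i j q := (ContinuousLinearMap.snd ℝ E F).comp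
    ((jac (I.prod 𝓘(ℝ, F)) i.1.1 j.1.1 q.1).comp
      ((ContinuousLinearMap.inl ℝ E F + (ContinuousLinearMap.inr ℝ E F).comp q.2).comp
        (jac I j.1.2 i.1.2 (transition (I.prod 𝓘(ℝ, F)) i.1.1 j.1.1 q.1).1)))
  change_smooth i j := by
    change ContDiffOn ℝ ∞ _ (overlap (I.prod 𝓘(ℝ, F)) i.1.1 j.1.1 ×ˢ univ)
    have h1 : ContDiffOn ℝ ∞ (fun q : (E × F) × (E →L[ℝ] F) =>
        jac (I.prod 𝓘(ℝ, F)) i.1.1 j.1.1 q.1)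
        (overlap (I.prod 𝓘(ℝ, F)) i.1.1 j.1.1 ×ˢ univ) :=
      (contDiffOn_jac i.2.mem_total j.2.mem_total).comp contDiff_fst.contDiffOn fun q hq => hq.1
    have h2 : ContDiffOn ℝ ∞ (fun q : (E × F) × (E →L[ℝ] F) =>
        (transition (I.prod 𝓘(ℝ, F)) i.1.1 j.1.1 q.1).1)
        (overlap (I.prod 𝓘(ℝ, F)) i.1.1 j.1.1 ×ˢ univ) :=
      contDiff_fst.comp_contDiffOn
        ((contDiffOn_transition i.2.mem_total j.2.mem_total).comp contDiff_fst.contDiffOn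
          fun q hq => hq.1)
    have h3 : ContDiffOn ℝ ∞ (fun q : (E × F) × (E →L[ℝ] F) =>
        jac I j.1.2 i.1.2 (transition (I.prod 𝓘(ℝ, F)) i.1.1 j.1.1 q.1).1)
        (overlap (I.prod 𝓘(ℝ, F)) i.1.1 j.1.1 ×ˢ univ) := by
      refine (contDiffOn_jac j.2.mem_base i.2.mem_base).comp h2 ?_
      rintro q ⟨⟨hq1, hq2⟩, -⟩
      obtain ⟨h, hh⟩ := hq2
      have hq1' : (i.1.1.symm h) ∈ i.1.1.source ∧ (i.1.1.symm h) ∈ j.1.1.source ∧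
          h ∈ i.1.1.target := by
        rw [mem_preimage, ← hh, ModelWithCorners.left_inv] at hq1
        simp only [mfld_simps] at hq1
        exact ⟨i.1.1.map_target hq1.1, hq1.2, hq1.1⟩
      have h4 : q.1 = (I.prod 𝓘(ℝ, F)) (i.1.1 (i.1.1.symm h)) := by
        rw [i.1.1.right_inv hq1'.2.2, hh]
      change (transition (I.prod 𝓘(ℝ, F)) i.1.1 j.1.1 q.1).1 ∈ _
      rw [h4, transition_apply hq1'.1]
      change I (j.1.1 (i.1.1.symm h)).1 ∈ _
      rw [j.2.fst_eq _ hq1'.2.1]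
      exact mem_overlap (j.2.mapsTo _ hq1'.2.1) (i.2.mapsTo _ hq1'.1)
    exact contDiffOn_const.clm_comp (h1.clm_comp ((contDiffOn_const.add
      (contDiffOn_const.clm_comp contDiff_snd.contDiffOn)).clm_comp h3))
  change_eq i j y hi hj s := by
    ext v
    rw [transition_apply hi]
    change _ = (jac (I.prod 𝓘(ℝ, F)) i.1.1 j.1.1 ((I.prod 𝓘(ℝ, F)) (i.1.1 y))
      ((ContinuousLinearMap.inl ℝ E F + (ContinuousLinearMap.inr ℝ E F).comp (π.jetTriv i y hi s))
        (jac I j.1.2 i.1.2 (I (j.1.1 y).1) v))).2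
    rw [j.2.fst_eq y hj]
    obtain ⟨w, rfl⟩ : ∃ w, v = tangentMapAt I I j.1.2 (π.proj y) w :=
      ⟨_, (tangentMapAt_chart_symm j.2.mem_base (j.2.mapsTo y hj) v).symm⟩
    rw [jac_comp j.2.mem_base i.2.mem_base (j.2.mapsTo y hj) (i.2.mapsTo y hi)]
    have h5 : (ContinuousLinearMap.inl ℝ E F +
        (ContinuousLinearMap.inr ℝ E F).comp (π.jetTriv i y hi s))
        (tangentMapAt I I i.1.2 (π.proj y) w) =
        tangentMapAt (I.prod 𝓘(ℝ, F)) (I.prod 𝓘(ℝ, F)) i.1.1 y (s.1 w) := by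
      have h1 := fst_tangentMapAt i hi (s.1 w)
      have h2 : π.tangentProj y (s.1 w) = w := DFunLike.congr_fun s.2 w
      rw [h2] at h1
      simp only [ContinuousLinearMap.comp_apply, add_apply, jetTriv_apply]
      rw [← h1]
      simp
    rw [h5, jac_comp i.2.mem_total j.2.mem_total hi hj, jetTriv_apply]

/-- The first jet bundle `Z = J¹π`. -/
abbrev Jet : Type _ := Total π.jetCharts

/-- The model of `J¹π`. -/
abbrev jetModel (_π : Fibration I F X Y) :
    ModelWithCorners ℝ ((E × F) × (E →L[ℝ] F)) (ModelProd (ModelProd H F) (E →L[ℝ] F)) :=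
  (I.prod 𝓘(ℝ, F)).prod 𝓘(ℝ, E →L[ℝ] F)

end Fibration
end JetBundle

section SemiForms

variable {W : Type*} [NormedAddCommGroup W] [NormedSpace ℝ W]
  {W' : Type*} [NormedAddCommGroup W'] [NormedSpace ℝ W']
  {A : Type*} [NormedAddCommGroup A] [NormedSpace ℝ A]
  {B : Type*} [NormedAddCommGroup B] [NormedSpace ℝ B]

/-- Linear subspaces of the space of alternating `k`-forms on `W`. -/
abbrev FormSubspace (W : Type*) [NormedAddCommGroup W] [NormedSpace ℝ W] (k : ℕ) : Type _ :=
  @Submodule ℝ (W [⋀^Fin k]→L[ℝ] ℝ) _ NormedAddCommGroup.toAddCommGroup.toAddCommMonoid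
    NormedSpace.toModule

/-- The alternating `k`-forms on `W` that vanish as soon as `r` of their arguments lie in the
subspace `V`. -/
def semiForms (V : Submodule ℝ W) (k r : ℕ) : FormSubspace W k where
  carrier := {w | ∀ (v : Fin k → W) (s : Finset (Fin k)), s.card = r → (∀ i ∈ s, v i ∈ V) → w v = 0}
  add_mem' := by
    intro a b ha hb v s hs hv
    change a v + b v = 0
    rw [ha v s hs hv, hb v s hs hv, add_zero]
  zero_mem' := fun _ _ _ _ => rfl
  smul_mem' := by
    intro c a ha v s hs hv
    change c • a v = 0
    rw [ha v s hs hv, smul_zero]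

theorem comp_mem_semiForms {V : Submodule ℝ W} {V' : Submodule ℝ W'} {k r : ℕ} (T : W →L[ℝ] W')
    (hT : ∀ v ∈ V, T v ∈ V') {w : W' [⋀^Fin k]→L[ℝ] ℝ} (hw : w ∈ semiForms V' k r) :
    w.compContinuousLinearMap T ∈ semiForms V k r :=
  fun v s hs hv => hw (T ∘ v) s hs fun i hi => hT _ (hv i hi)

/-- Mutually inverse linear maps `T : W → W'`, `T' : W' → W` that match the subspaces `V`, `V'`
identify the corresponding spaces of forms. -/
def semiFormsEquiv {V : Submodule ℝ W} {V' : Submodule ℝ W'} (k r : ℕ) (T : W →L[ℝ] W')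
    (T' : W' →L[ℝ] W) (h : ∀ v, T' (T v) = v) (h' : ∀ v, T (T' v) = v)
    (hT : ∀ v ∈ V, T v ∈ V') (hT' : ∀ v ∈ V', T' v ∈ V) :
    semiForms V k r ≃ₗ[ℝ] semiForms V' k r where
  toFun w := ⟨w.1.compContinuousLinearMap T', comp_mem_semiForms T' hT' w.2⟩
  invFun w := ⟨w.1.compContinuousLinearMap T, comp_mem_semiForms T hT w.2⟩
  map_add' _ _ := rfl
  map_smul' _ _ := rfl
  left_inv w := Subtype.ext <| ContinuousAlternatingMap.ext fun v => by
    change w.1 (fun i => T' (T (v i))) = w.1 v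
    simp only [h]
  right_inv w := Subtype.ext <| ContinuousAlternatingMap.ext fun v => by
    change w.1 (fun i => T (T' (v i))) = w.1 v
    simp only [h']

/-- A linear left inverse of an injective linear map of finite-dimensional spaces. -/
def leftInv [FiniteDimensional ℝ B] (j : A →L[ℝ] B) (hj : Function.Injective j) : B →L[ℝ] A :=
  LinearMap.toContinuousLinearMap
    (j.toLinearMap.exists_leftInverse_of_injective (LinearMap.ker_eq_bot.2 hj)).choose

theorem leftInv_apply [FiniteDimensional ℝ B] (j : A →L[ℝ] B) (hj : Function.Injective j) (a : A) :
    leftInv j hj (j a) = a :=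
  LinearMap.congr_fun
    (j.toLinearMap.exists_leftInverse_of_injective (LinearMap.ker_eq_bot.2 hj)).choose_spec a

/-- A linear section of the projection to a quotient. -/
def quotSection [FiniteDimensional ℝ A] (S : Submodule ℝ A) [IsClosed (S : Set A)] :
    (A ⧸ S) →L[ℝ] A :=
  LinearMap.toContinuousLinearMap
    (S.mkQ.exists_rightInverse_of_surjective S.range_mkQ).choose

theorem mk_quotSection [FiniteDimensional ℝ A] (S : Submodule ℝ A) [IsClosed (S : Set A)]
    (a : A ⧸ S) : S.mkQ (quotSection S a) = a :=
  LinearMap.congr_fun (S.mkQ.exists_rightInverse_of_surjective S.range_mkQ).choose_spec a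

/-- The projection to a quotient as a continuous linear map. -/
def quotProj [FiniteDimensional ℝ A] (S : Submodule ℝ A) [IsClosed (S : Set A)] :
    A →L[ℝ] (A ⧸ S) := LinearMap.toContinuousLinearMap S.mkQ

theorem contDiff_quotProj [FiniteDimensional ℝ A] (S : Submodule ℝ A) [IsClosed (S : Set A)] :
    ContDiff ℝ ∞ (quotProj S) :=
  (quotProj S).contDiff

theorem contDiff_quotSection [FiniteDimensional ℝ A] (S : Submodule ℝ A) [IsClosed (S : Set A)] :
    ContDiff ℝ ∞ (quotSection S) := (quotSection S).contDiff

theorem contDiffOn_quot {P : Type*} [NormedAddCommGroup P] [NormedSpace ℝ P]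
    [FiniteDimensional ℝ A] (S : Submodule ℝ A) [IsClosed (S : Set A)] (g : P × A → A) (s : Set P)
    (hg : ContDiffOn ℝ ∞ g (s ×ˢ univ)) :
    ContDiffOn ℝ ∞ (fun q : P × (A ⧸ S) => quotProj S (g (q.1, quotSection S q.2)))
      (s ×ˢ univ) := by
  refine (contDiff_quotProj S).comp_contDiffOn (hg.comp
    (contDiff_fst.prodMk ((contDiff_quotSection S).comp contDiff_snd)).contDiffOn ?_)
  exact fun q hq => ⟨hq.1, mem_univ _⟩

instance finiteDimensional_multilinear [FiniteDimensional ℝ W] (k : ℕ) :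
    @FiniteDimensional ℝ (ContinuousMultilinearMap ℝ (fun _ : Fin k => W) ℝ) _
      NormedAddCommGroup.toAddCommGroup NormedSpace.toModule :=
  FiniteDimensional.of_injective
    (ContinuousMultilinearMap.toMultilinearMapLinear (R' := ℝ) (A := ℝ)
      (M₁ := fun _ : Fin k => W) (M₂ := ℝ))
    ContinuousMultilinearMap.toMultilinearMap_injective

theorem contDiff_comp_multilinear (k : ℕ) :
    ContDiff ℝ ∞ (fun p : (ContinuousMultilinearMap ℝ (fun _ : Fin k => W) ℝ) × (W →L[ℝ] W) =>
      p.1.compContinuousLinearMap (fun _ => p.2)) := by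
  have h3 := ContinuousMultilinearMap.contDiff (𝕜 := ℝ) (n := ∞)
    (F := (ContinuousMultilinearMap ℝ (fun _ : Fin k => W) ℝ) →L[ℝ]
      (ContinuousMultilinearMap ℝ (fun _ : Fin k => W) ℝ)) (E := fun _ : Fin k => W →L[ℝ] W)
    (ContinuousMultilinearMap.compContinuousLinearMapContinuousMultilinear ℝ
      (fun _ : Fin k => W) (fun _ : Fin k => W) ℝ)
  have h4 : ContDiff ℝ ∞ (fun p : (ContinuousMultilinearMap ℝ (fun _ : Fin k => W) ℝ) ×
      (W →L[ℝ] W) => (fun _ : Fin k => p.2)) := contDiff_pi.2 fun _ => contDiff_snd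
  exact (h3.comp h4).clm_apply contDiff_fst

/-- The inclusion of `semiForms V k r` in the space of all multilinear forms. -/
def semiFormsIncl (V : Submodule ℝ W) (k r : ℕ) :
    semiForms V k r →L[ℝ] ContinuousMultilinearMap ℝ (fun _ : Fin k => W) ℝ :=
  (ContinuousAlternatingMap.toContinuousMultilinearMapCLM ℝ).comp (semiForms V k r).subtypeL

theorem semiFormsIncl_injective (V : Submodule ℝ W) (k r : ℕ) :
    Function.Injective (semiFormsIncl V k r) :=
  ContinuousAlternatingMap.toContinuousMultilinearMap_injective.comp Subtype.val_injective

instance finiteDimensional_semiForms [FiniteDimensional ℝ W] (V : Submodule ℝ W) (k r : ℕ) :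
    FiniteDimensional ℝ (semiForms V k r) :=
  FiniteDimensional.of_injective (semiFormsIncl V k r).toLinearMap (semiFormsIncl_injective V k r)

/-- A linear retraction of the multilinear forms onto `semiForms V k r`. -/
def semiFormsRetract [FiniteDimensional ℝ W] (V : Submodule ℝ W) (k r : ℕ) :
    ContinuousMultilinearMap ℝ (fun _ : Fin k => W) ℝ →L[ℝ] semiForms V k r :=
  leftInv (semiFormsIncl V k r) (semiFormsIncl_injective V k r)

theorem semiFormsRetract_incl [FiniteDimensional ℝ W] (V : Submodule ℝ W) (k r : ℕ)
    (w : semiForms V k r) : semiFormsRetract V k r (semiFormsIncl V k r w) = w :=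
  leftInv_apply (semiFormsIncl V k r) (semiFormsIncl_injective V k r) w

/-- The pullback of forms by `T`, composed with the retraction onto `semiForms V k r`; if `T` maps
`V` to itself, this is just the pullback. -/
def semiFormsPull [FiniteDimensional ℝ W] (V : Submodule ℝ W) (k r : ℕ)
    (w : semiForms V k r) (T : W →L[ℝ] W) : semiForms V k r :=
  semiFormsRetract V k r ((semiFormsIncl V k r w).compContinuousLinearMap fun _ => T)

theorem semiFormsPull_eq [FiniteDimensional ℝ W] (V : Submodule ℝ W) (k r : ℕ)
    (w w' : semiForms V k r) (T : W →L[ℝ] W) (h : ∀ v : Fin k → W, w'.1 v = w.1 (T ∘ v)) :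
    w' = semiFormsPull V k r w T := by
  rw [semiFormsPull, ← semiFormsRetract_incl V k r w']
  congr 1
  exact ContinuousMultilinearMap.ext h

theorem contDiff_semiFormsPull [FiniteDimensional ℝ W] (V : Submodule ℝ W) (k r : ℕ) :
    ContDiff ℝ ∞ (fun p : semiForms V k r × (W →L[ℝ] W) => semiFormsPull V k r p.1 p.2) :=
  (semiFormsRetract V k r).contDiff.comp ((contDiff_comp_multilinear k).comp
    (((semiFormsIncl V k r).contDiff.comp contDiff_fst).prodMk contDiff_snd))

/-- The forms of `semiForms V k 2` modulo those of `semiForms V k 1`. -/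
abbrev SemiFormsQuot (V : Submodule ℝ W) (k : ℕ) : Type _ :=
  semiForms V k 2 ⧸ (semiForms V k 1).submoduleOf (semiForms V k 2)

instance isClosed_submoduleOf [FiniteDimensional ℝ W] (V : Submodule ℝ W) (k : ℕ) :
    IsClosed ((semiForms V k 1).submoduleOf (semiForms V k 2) : Set (semiForms V k 2)) :=
  Submodule.closed_of_finiteDimensional _

end SemiForms

section DualJetBundle

variable {E : Type*} [NormedAddCommGroup E] [NormedSpace ℝ E] [FiniteDimensional ℝ E]
  {H : Type*} [TopologicalSpace H] {I : ModelWithCorners ℝ E H}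
  {F : Type*} [NormedAddCommGroup F] [NormedSpace ℝ F] [FiniteDimensional ℝ F]
  {X : Type*} [TopologicalSpace X] [ChartedSpace H X]
  {Y : Type*} [TopologicalSpace Y] [ChartedSpace (ModelProd H F) Y]

/-- The vertical subspace `0 × F` of the model `E × F`. -/
def modelVertical (E : Type*) [NormedAddCommGroup E] [NormedSpace ℝ E] (F : Type*)
    [NormedAddCommGroup F] [NormedSpace ℝ F] : Submodule ℝ (E × F) :=
  LinearMap.ker (ContinuousLinearMap.fst ℝ E F).toLinearMap

namespace Fibration

variable (π : Fibration I F X Y)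

/-- The fibre over `y` of the bundle of `k`-forms on `Y` that vanish on any `r` vertical vectors. -/
abbrev FormFibre (k r : ℕ) (y : Y) : Type _ := semiForms (π.vertical y) k r

/-- The fibre over `y` of the dual jet bundle, where `k = dim X`. -/
abbrev DualFibre (k : ℕ) (y : Y) : Type _ := SemiFormsQuot (π.vertical y) k

variable [IsManifold I ∞ X] [IsManifold (I.prod 𝓘(ℝ, F)) ∞ Y]

theorem map_vertical (i : π.AdaptedCharts) (y : Y) (hy : y ∈ i.1.1.source) :
    ∀ v ∈ π.vertical y,
      tangentMapAt (I.prod 𝓘(ℝ, F)) (I.prod 𝓘(ℝ, F)) i.1.1 y v ∈ modelVertical E F := by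
  intro v hv
  have hv' : π.tangentProj y v = 0 := hv
  change (tangentMapAt (I.prod 𝓘(ℝ, F)) (I.prod 𝓘(ℝ, F)) i.1.1 y v).1 = 0
  rw [fst_tangentMapAt i hy, hv', map_zero]

theorem map_modelVertical (i : π.AdaptedCharts) (y : Y) (hy : y ∈ i.1.1.source) :
    ∀ v ∈ modelVertical E F,
      tangentMapAt (I.prod 𝓘(ℝ, F)) (I.prod 𝓘(ℝ, F)) i.1.1.symm (i.1.1 y) v ∈ π.vertical y := by
  intro v hv
  have hv' : v.1 = 0 := hv
  have h := fst_tangentMapAt i hy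
    (tangentMapAt (I.prod 𝓘(ℝ, F)) (I.prod 𝓘(ℝ, F)) i.1.1.symm (i.1.1 y) v)
  rw [tangentMapAt_chart_symm i.2.mem_total hy, hv'] at h
  have h2 := congrArg (tangentMapAt I I i.1.2.symm (i.1.2 (π.proj y))) h
  rw [tangentMapAt_symm_chart i.2.mem_base (i.2.mapsTo y hy), map_zero] at h2
  exact h2.symm

/-- The coordinates induced by fibred coordinates on the bundle of `k`-forms that vanish on `r`
vertical vectors. -/
def formTriv (k r : ℕ) (i : π.AdaptedCharts) (y : Y) (hy : y ∈ i.1.1.source) :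
    π.FormFibre k r y ≃ₗ[ℝ] semiForms (modelVertical E F) k r :=
  semiFormsEquiv k r (tangentMapAt (I.prod 𝓘(ℝ, F)) (I.prod 𝓘(ℝ, F)) i.1.1 y)
    (tangentMapAt (I.prod 𝓘(ℝ, F)) (I.prod 𝓘(ℝ, F)) i.1.1.symm (i.1.1 y))
    (tangentMapAt_symm_chart i.2.mem_total hy) (tangentMapAt_chart_symm i.2.mem_total hy)
    (π.map_vertical i y hy) (π.map_modelVertical i y hy)

/-- The change of coordinates on the bundle of forms. -/
def formChange (k r : ℕ) (i j : π.AdaptedCharts)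
    (q : (E × F) × semiForms (modelVertical E F) k r) : semiForms (modelVertical E F) k r :=
  semiFormsPull (modelVertical E F) k r q.2
    (jac (I.prod 𝓘(ℝ, F)) j.1.1 i.1.1 (transition (I.prod 𝓘(ℝ, F)) i.1.1 j.1.1 q.1))

theorem formChange_smooth (k r : ℕ) (i j : π.AdaptedCharts) :
    ContDiffOn ℝ ∞ (π.formChange k r i j)
      (overlap (I.prod 𝓘(ℝ, F)) i.1.1 j.1.1 ×ˢ univ) := by
  have h2 : ContDiffOn ℝ ∞ (fun q : (E × F) × semiForms (modelVertical E F) k r =>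
      jac (I.prod 𝓘(ℝ, F)) j.1.1 i.1.1 (transition (I.prod 𝓘(ℝ, F)) i.1.1 j.1.1 q.1))
      (overlap (I.prod 𝓘(ℝ, F)) i.1.1 j.1.1 ×ˢ univ) := by
    refine (contDiffOn_jac j.2.mem_total i.2.mem_total).comp
      ((contDiffOn_transition i.2.mem_total j.2.mem_total).comp contDiff_fst.contDiffOn
          fun q hq => hq.1) ?_
    rintro q ⟨⟨hq1, hq2⟩, -⟩
    obtain ⟨h, hh⟩ := hq2
    have hq1' : (i.1.1.symm h) ∈ i.1.1.source ∧ (i.1.1.symm h) ∈ j.1.1.source ∧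
        h ∈ i.1.1.target := by
      rw [mem_preimage, ← hh, ModelWithCorners.left_inv] at hq1
      simp only [mfld_simps] at hq1
      exact ⟨i.1.1.map_target hq1.1, hq1.2, hq1.1⟩
    have h4 : q.1 = (I.prod 𝓘(ℝ, F)) (i.1.1 (i.1.1.symm h)) := by
      rw [i.1.1.right_inv hq1'.2.2, hh]
    change transition (I.prod 𝓘(ℝ, F)) i.1.1 j.1.1 q.1 ∈ _
    rw [h4, transition_apply hq1'.1]
    exact mem_overlap hq1'.2.1 hq1'.1
  exact (contDiff_semiFormsPull (modelVertical E F) k r).comp_contDiffOn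
    (contDiff_snd.contDiffOn.prodMk h2)

theorem formChange_eq (k r : ℕ) (i j : π.AdaptedCharts) (y : Y) (hi : y ∈ i.1.1.source)
    (hj : y ∈ j.1.1.source) (w : π.FormFibre k r y) :
    π.formTriv k r j y hj w =
      π.formChange k r i j ((I.prod 𝓘(ℝ, F)) (i.1.1 y), π.formTriv k r i y hi w) := by
  rw [formChange, transition_apply hi]
  refine semiFormsPull_eq _ _ _ _ _ _ fun v => ?_
  change w.1 (fun l => tangentMapAt (I.prod 𝓘(ℝ, F)) (I.prod 𝓘(ℝ, F)) j.1.1.symm (j.1.1 y) (v l)) =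
    w.1 (fun l => tangentMapAt (I.prod 𝓘(ℝ, F)) (I.prod 𝓘(ℝ, F)) i.1.1.symm (i.1.1 y)
      (jac (I.prod 𝓘(ℝ, F)) j.1.1 i.1.1 ((I.prod 𝓘(ℝ, F)) (j.1.1 y)) (v l)))
  congr 1
  funext l
  obtain ⟨u, hu⟩ : ∃ u, v l = tangentMapAt (I.prod 𝓘(ℝ, F)) (I.prod 𝓘(ℝ, F)) j.1.1 y u :=
    ⟨_, (tangentMapAt_chart_symm j.2.mem_total hj (v l)).symm⟩
  rw [hu, jac_comp j.2.mem_total i.2.mem_total hj hi, tangentMapAt_symm_chart j.2.mem_total hj,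
    tangentMapAt_symm_chart i.2.mem_total hi]

/-- The smooth structure of the bundle `Λ^k_r Y` of `k`-forms on `Y` that vanish on any `r`
vertical vectors. -/
def formCharts (k r : ℕ) : FibreCharts (I.prod 𝓘(ℝ, F)) (semiForms (modelVertical E F) k r)
    (π.FormFibre k r) π.AdaptedCharts where
  base i := i.1.1
  base_mem i := i.2.mem_total
  idx := π.adaptedAt
  mem_idx := π.mem_adaptedAt
  triv i y hy := (π.formTriv k r i y hy).toEquiv
  change := π.formChange k r
  change_smooth := π.formChange_smooth k r
  change_eq := π.formChange_eq k r

/-- The coordinates induced by fibred coordinates on the dual jet bundle. -/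
def dualTriv (k : ℕ) (i : π.AdaptedCharts) (y : Y) (hy : y ∈ i.1.1.source) :
    π.DualFibre k y ≃ₗ[ℝ] SemiFormsQuot (modelVertical E F) k :=
  Submodule.Quotient.equiv _ _ (π.formTriv k 2 i y hy) (by
    ext w
    constructor
    · rintro ⟨w', hw', rfl⟩
      exact (π.formTriv k 1 i y hy ⟨w'.1, hw'⟩).2
    · intro hw
      exact ⟨(π.formTriv k 2 i y hy).symm w, ((π.formTriv k 1 i y hy).symm ⟨w.1, hw⟩).2,
        LinearEquiv.apply_symm_apply _ _⟩)

/-- The smooth structure of the dual jet bundle. -/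
def dualCharts (k : ℕ) : FibreCharts (I.prod 𝓘(ℝ, F)) (SemiFormsQuot (modelVertical E F) k)
    (π.DualFibre k) π.AdaptedCharts where
  base i := i.1.1
  base_mem i := i.2.mem_total
  idx := π.adaptedAt
  mem_idx := π.mem_adaptedAt
  triv i y hy := (π.dualTriv k i y hy).toEquiv
  change i j q := quotProj _ (π.formChange k 2 i j (q.1, quotSection _ q.2))
  change_smooth i j :=
    contDiffOn_quot ((semiForms (modelVertical E F) k 1).submoduleOf
      (semiForms (modelVertical E F) k 2)) _ _ (π.formChange_smooth k 2 i j)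
  change_eq i j y hi hj w := by
    set w' : π.FormFibre k 2 y := (π.formTriv k 2 i y hi).symm
      (quotSection _ (π.dualTriv k i y hi w)) with hw'
    have h1 : Submodule.Quotient.mk w' = w := by
      apply (π.dualTriv k i y hi).injective
      change Submodule.Quotient.mk (π.formTriv k 2 i y hi w') = _
      rw [hw', LinearEquiv.apply_symm_apply]
      exact mk_quotSection _ _
    have h2 := π.formChange_eq k 2 i j y hi hj w'
    rw [hw', LinearEquiv.apply_symm_apply, ← hw'] at h2
    change π.dualTriv k j y hj w = Submodule.Quotient.mk (π.formChange k 2 i j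
      ((I.prod 𝓘(ℝ, F)) (i.1.1 y), quotSection _ (π.dualTriv k i y hi w)))
    rw [← h2, ← h1]
    rfl

end Fibration
end DualJetBundle

section Wedge

variable {W : Type*} [NormedAddCommGroup W] [NormedSpace ℝ W] [FiniteDimensional ℝ W]
  {E : Type*} [NormedAddCommGroup E] [NormedSpace ℝ E]
  {V : Type*} [NormedAddCommGroup V] [NormedSpace ℝ V]

/-- The exterior product `θ ∧ g` of a `1`-form `θ` with values in `V` and an `n`-form `g` with
values in `E^*`; it takes its values in `E^* ⊗ V`, i.e. in the linear maps `E → V`. -/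
def wedgeOne {n : ℕ} (θ : W →L[ℝ] V) (g : W [⋀^Fin n]→L[ℝ] (E →L[ℝ] ℝ)) :
    W [⋀^Fin (n + 1)]→L[ℝ] (E →L[ℝ] V) :=
  ContinuousAlternatingMap.alternatizeUncurryFin
    (LinearMap.toContinuousLinearMap
      { toFun := fun w =>
          ((ContinuousLinearMap.smulRightL ℝ E V).flip (θ w)).compContinuousAlternatingMap g
        map_add' := fun _ _ => by ext; simp
        map_smul' := fun _ _ => by ext; simp })

theorem wedgeOne_apply {n : ℕ} (θ : W →L[ℝ] V) (g : W [⋀^Fin n]→L[ℝ] (E →L[ℝ] ℝ))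
    (w : Fin (n + 1) → W) (u : E) :
    wedgeOne θ g w u = ∑ j : Fin (n + 1), (-1 : ℤ) ^ (j : ℕ) • g (j.removeNth w) u • θ (w j) := by
  simp [wedgeOne, ContinuousAlternatingMap.alternatizeUncurryFin_apply]

end Wedge

section PoincareCartan

variable {E : Type*} [NormedAddCommGroup E] [NormedSpace ℝ E] [FiniteDimensional ℝ E]
  {H : Type*} [TopologicalSpace H] {I : ModelWithCorners ℝ E H}
  {F : Type*} [NormedAddCommGroup F] [NormedSpace ℝ F] [FiniteDimensional ℝ F]
  {X : Type*} [TopologicalSpace X] [ChartedSpace H X]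
  {Y : Type*} [TopologicalSpace Y] [ChartedSpace (ModelProd H F) Y]

/-- A volume form: a smooth nowhere vanishing form of degree `k = dim X`. -/
structure DForm.IsVolumeForm {k : ℕ} (η : DForm I X k) : Prop where
  finrank_eq : Module.finrank ℝ E = k
  smooth : η.IsSmooth
  ne_zero : ∀ x, η x ≠ 0

namespace Fibration

variable (π : Fibration I F X Y) [IsManifold I ∞ X] [IsManifold (I.prod 𝓘(ℝ, F)) ∞ Y]

/-- The projection `π_{XZ} : Z → X` of the jet bundle on the base. -/
def jetProj (z : π.Jet) : X := π.proj z.pt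

/-- The tangent map `T_z π_{YZ}` of the projection `π_{YZ} : Z → Y`. -/
def tangentJet (z : π.Jet) : (E × F) × (E →L[ℝ] F) →L[ℝ] E × F :=
  tangentMapAt π.jetModel (I.prod 𝓘(ℝ, F)) Total.pt z

/-- The vertical part of a tangent vector `V` at a jet `z = j¹_x φ`, namely
`T π_{YZ} (V) - T_x φ (T π_{XZ} (V))`; in coordinates it is given by the contact forms
`dy^i - z^i_μ dx^μ`. Here `T π_{XZ} = T π ∘ T π_{YZ}` and `T_x φ` is the linear map `z.fib`. -/
def contact (z : π.Jet) : (E × F) × (E →L[ℝ] F) →L[ℝ] π.vertical z.pt :=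
  (π.tangentJet z - z.fib.1.comp ((π.tangentProj z.pt).comp (π.tangentJet z))).codRestrict
    (π.vertical z.pt) fun V => by
      have h : ∀ u, π.tangentProj z.pt (z.fib.1 u) = u := DFunLike.congr_fun z.fib.2
      change π.tangentProj z.pt (π.tangentJet z V -
        z.fib.1 (π.tangentProj z.pt (π.tangentJet z V))) = 0
      rw [map_sub, h, sub_self]

/-- The translation of a jet `z` over `y` by a linear map `f : T_x X → V_y π`: the jet bundle is an
affine bundle over `Y`. -/
def translate (z : π.Jet) (f : E →L[ℝ] π.vertical z.pt) : π.Jet :=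
  ⟨z.pt, z.fib.1 + (π.vertical z.pt).subtypeL.comp f, by
    ext u
    have h : π.tangentProj z.pt (z.fib.1 u) = u := DFunLike.congr_fun z.fib.2 u
    have h' : π.tangentProj z.pt (f u : E × F) = 0 := (f u).2
    change π.tangentProj z.pt (z.fib.1 u + (f u : E × F)) = u
    rw [map_add, h, h', add_zero]⟩

/-- The vertical lift `f ↦ f^v = d/dt (z + t f)|_{t = 0}`, from linear maps `T_x X → V_y π` to
tangent vectors at `z` that are vertical over `Y`. -/
def verticalLift (z : π.Jet) : (E →L[ℝ] π.vertical z.pt) →L[ℝ] (E × F) × (E →L[ℝ] F) :=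
  tangentMapAt 𝓘(ℝ, E →L[ℝ] π.vertical z.pt) π.jetModel (π.translate z) 0

/-- The form `η (u, T π_{XZ} V_1, …, T π_{XZ} V_n)` in `V_1, …, V_n`, with values in the linear
forms in `u ∈ T_x X`. -/
def volumeContraction {n : ℕ} (η : DForm I X (n + 1)) (z : π.Jet) :
    ((E × F) × (E →L[ℝ] F)) [⋀^Fin n]→L[ℝ] (E →L[ℝ] ℝ) :=
  ((η (π.jetProj z)).curryLeft.flipAlternating).compContinuousLinearMap
    ((π.tangentProj z.pt).comp (π.tangentJet z))

/-- The vertical endomorphism `S_η`, a form of degree `n + 1` on `Z` with values in the tangent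
vectors that are vertical over `Y`:
`S_η (V_0, …, V_n) = ∑ j, (-1)^j (η_j ⊗ θ (V_j))^v`, where `θ (V_j)` is the vertical part of `V_j`
and `η_j (u) = η (u, T π_{XZ} V_0, …, T π_{XZ} V_n)` with the argument `V_j` omitted. In
coordinates, `S_η = (dy^i - z^i_μ dx^μ) ∧ d^n x_ν ⊗ ∂/∂z^i_ν`. -/
def verticalEndomorphism {n : ℕ} (η : DForm I X (n + 1)) (z : π.Jet) :
    ((E × F) × (E →L[ℝ] F)) [⋀^Fin (n + 1)]→L[ℝ] ((E × F) × (E →L[ℝ] F)) :=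
  (π.verticalLift z).compContinuousAlternatingMap
    (wedgeOne (π.contact z)
      (π.volumeContraction η z))

/-- The Poincaré-Cartan form `Θ_L = L η + S_η^* (dL)` of the Lagrangian form `L η`. -/
def poincareCartan {n : ℕ} (η : DForm I X (n + 1)) (L : π.Jet → ℝ) :
    DForm π.jetModel π.Jet (n + 1) := fun z =>
  L z • DForm.pullback (I := π.jetModel) π.jetProj η z +
    (tangentMapAt π.jetModel 𝓘(ℝ, ℝ) L z).compContinuousAlternatingMap
      (π.verticalEndomorphism η z)

end Fibration
end PoincareCartan

section Hamiltonian

variable {E : Type*} [NormedAddCommGroup E] [NormedSpace ℝ E] [FiniteDimensional ℝ E]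
  {H : Type*} [TopologicalSpace H] {I : ModelWithCorners ℝ E H}
  {F : Type*} [NormedAddCommGroup F] [NormedSpace ℝ F] [FiniteDimensional ℝ F]
  {X : Type*} [TopologicalSpace X] [ChartedSpace H X]
  {Y : Type*} [TopologicalSpace Y] [ChartedSpace (ModelProd H F) Y]

namespace Fibration

variable (π : Fibration I F X Y) [IsManifold I ∞ X] [IsManifold (I.prod 𝓘(ℝ, F)) ∞ Y]

/-- The bundle `Λ^k_r Y` of the `k`-forms on `Y` that vanish on any `r` vertical vectors. -/
abbrev FormBundle (k r : ℕ) : Type _ := Total (π.formCharts k r)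

/-- The model of `Λ^k_r Y`. -/
abbrev formModel (_π : Fibration I F X Y) (k r : ℕ) :
    ModelWithCorners ℝ ((E × F) × semiForms (modelVertical E F) k r)
      (ModelProd (ModelProd H F) (semiForms (modelVertical E F) k r)) :=
  (I.prod 𝓘(ℝ, F)).prod 𝓘(ℝ, semiForms (modelVertical E F) k r)

/-- The dual jet bundle `Z^* = Λ^k_2 Y / Λ^k_1 Y`, where `k = dim X`. -/
abbrev DualJet (k : ℕ) : Type _ := Total (π.dualCharts k)

/-- The model of the dual jet bundle. -/
abbrev dualModel (_π : Fibration I F X Y) (k : ℕ) :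
    ModelWithCorners ℝ ((E × F) × SemiFormsQuot (modelVertical E F) k)
      (ModelProd (ModelProd H F) (SemiFormsQuot (modelVertical E F) k)) :=
  (I.prod 𝓘(ℝ, F)).prod 𝓘(ℝ, SemiFormsQuot (modelVertical E F) k)

/-- The projection `π_{XZ^*} : Z^* → X`. -/
def dualProj (k : ℕ) (z : π.DualJet k) : X := π.proj z.pt

/-- The natural projection `μ : Λ^k_2 Y → Z^*`. -/
def toDual (k : ℕ) (w : π.FormBundle k 2) : π.DualJet k := ⟨w.pt, Submodule.Quotient.mk w.fib⟩

/-- The Liouville form `Θ` on `Λ^k_r Y`: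
`Θ_w (V_1, …, V_k) = w (T ν V_1, …, T ν V_k)`, where `ν` is the projection to `Y`. -/
def liouville (k r : ℕ) : DForm (π.formModel k r) (π.FormBundle k r) k := fun w =>
  w.fib.1.compContinuousLinearMap
    (tangentMapAt (π.formModel k r) (I.prod 𝓘(ℝ, F)) Total.pt w)

/-- A Hamiltonian: a smooth section `h : Z^* → Λ^k_2 Y` of `μ`. -/
structure IsHamiltonian {k : ℕ} (h : π.DualJet k → π.FormBundle k 2) : Prop where
  smooth : ContMDiff (π.dualModel k) (π.formModel k 2) ∞ h
  toDual_apply : ∀ z, π.toDual k (h z) = z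

/-- The form `Θ_h = h^* Θ` on the dual jet bundle. -/
def hamiltonCartan {k : ℕ} (h : π.DualJet k → π.FormBundle k 2) :
    DForm (π.dualModel k) (π.DualJet k) k :=
  DForm.pullback h (π.liouville k 2)

end Fibration
end Hamiltonian

section FieldEquations

variable {E : Type*} [NormedAddCommGroup E] [NormedSpace ℝ E]
  {H : Type*} [TopologicalSpace H] {I : ModelWithCorners ℝ E H}
  {X : Type*} [TopologicalSpace X] [ChartedSpace H X]
  {EW : Type*} [NormedAddCommGroup EW] [NormedSpace ℝ EW]
  {HW : Type*} [TopologicalSpace HW] {IW : ModelWithCorners ℝ EW HW}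
  {W : Type*} [TopologicalSpace W] [ChartedSpace HW W] [IsManifold IW ∞ W]
  {EB : Type*} [NormedAddCommGroup EB] [NormedSpace ℝ EB]
  {HB : Type*} [TopologicalSpace HB]

/-- The smooth section `σ` of `p : W → X` satisfies the field equations
`σ^* (ι_ζ Ω) = 0` for all vector fields `ζ` on `W`, where `Ω = -dΘ`. For `Θ = Θ_L` these are the
De Donder equations, for `Θ = Θ_h` the Hamilton equations. -/
structure SatisfiesFieldEquations {k : ℕ} (I : ModelWithCorners ℝ E H) (p : W → X)
    (Θ : DForm IW W k) (σ : X → W) : Prop where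
  smooth : ContMDiff I IW ∞ σ
  section_apply : ∀ x, p (σ x) = x
  equation : ∀ ζ : VField IW W, ζ.IsSmooth →
    DForm.pullback (I := I) σ (DForm.interior ζ (-Θ.d)) = 0

/-- The `n`-form `w` is a preserved quantity for the field equations of `Θ`: `σ^* dw = 0` for all
sections `σ` that satisfy them. -/
structure IsPreservedQuantity {k n : ℕ} (I : ModelWithCorners ℝ E H) (p : W → X)
    (Θ : DForm IW W k) (w : DForm IW W n) : Prop where
  smooth : w.IsSmooth
  preserved : ∀ σ : X → W, SatisfiesFieldEquations I p Θ σ →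
    DForm.pullback (I := I) σ w.d = 0

/-- A boundary condition for the form `Θ` on `p : W → X`: a submanifold `B` of `∂W = p⁻¹ (∂X)`,
given by its inclusion `i_B`, and an `n`-form `Π` on `B` with `i_B^* Θ = dΠ`. -/
structure BoundaryCondition {n : ℕ} (I : ModelWithCorners ℝ E H) (p : W → X)
    (Θ : DForm IW W (n + 1)) (IB : ModelWithCorners ℝ EB HB) (B : Type*) [TopologicalSpace B]
    [ChartedSpace HB B] where
  incl : B → W
  smooth_incl : ContMDiff IB IW ∞ incl
  isEmbedding_incl : Topology.IsEmbedding incl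
  injective_tangentMapAt : ∀ b, Function.Injective (tangentMapAt IB IW incl b)
  mem_boundary : ∀ b, p (incl b) ∈ I.boundary X
  potential : DForm IB B n
  smooth_potential : potential.IsSmooth
  d_potential : DForm.pullback incl Θ = potential.d

/-- The vector field `ξ` on `W` is a Cartan symmetry, with `£_ξ Θ = dα`: here `α` is an `n`-form on
`W` that is exact on `B`, and `ξ` is tangent to `B` with `£_{ξ|B} Π = 0`. -/
structure IsCartanSymmetry {n : ℕ} {p : W → X} {Θ : DForm IW W (n + 1)}
    {IB : ModelWithCorners ℝ EB HB} {B : Type*} [TopologicalSpace B] [ChartedSpace HB B]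
    (bc : BoundaryCondition I p Θ IB B) (ξ : VField IW W) (α : DForm IW W n) : Prop where
  smooth_field : ξ.IsSmooth
  smooth_form : α.IsSmooth
  lieDeriv_eq : Θ.lieDeriv ξ = α.d
  exact_on_boundary : (DForm.pullback (I := IB) bc.incl α).IsExact
  tangent_boundary : ∃ ξB : VField IB B,
    (∀ b, tangentMapAt IB IW bc.incl b (ξB b) = ξ (bc.incl b)) ∧ bc.potential.lieDeriv ξB = 0

end FieldEquations

end FieldTheory

end

open FieldTheory

/-! Both cases are instances of one statement about a smooth form `Θ` on `W → X`, and that statement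
rests on Cartan's formula `d ι_ξ Θ = £_ξ Θ - ι_ξ dΘ` (`DForm.d_interior`). If `£_ξ Θ = dα`, then `d
(ι_ξ Θ - α) = -ι_ξ dΘ = ι_ξ Ω`. The pullback of this form by a solution `σ` vanishes, since it is
the field equation for the vector field `ζ = ξ` (`IsCartanSymmetry.isPreservedQuantity`).

On the boundary, tangency of `ξ` to `B` gives `i_B^* ι_ξ Θ = ι_{ξ_B} i_B^* Θ = ι_{ξ_B} dΠ`
(`DForm.pullback_interior`). As `£_{ξ_B} Π = 0`, Cartan's formula on `B` turns this into `-d ι_{ξ_B}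
Π`, or into `0` when `Π` is a function; subtracting the exact form `i_B^* α` keeps it exact
(`DForm.IsSmooth.isExact_interior_d_sub`). The primitive has to be smooth, so `ξ_B` must be smooth.
This is not assumed: it follows from the injectivity of `T i_B`
(`VField.SmoothInCharts.of_related`).

The remaining work is to show that `Θ_L` and `Θ_h` are smooth, as Cartan's formula differentiates
them. Both are defined invariantly, with tangent maps, so they are first computed in the coordinates
induced by adapted charts. The coefficients of `Θ_h` are linear in the fibre coordinates of `h`
(`Fibration.IsHamiltonian.isSmooth_hamiltonCartan`). Those of `Θ_L` are polynomial in `L`, its first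
derivatives along the fibre, the coefficients of `η` and the jet coordinates
(`Fibration.isSmooth_poincareCartan`). -/

noncomputable section

namespace FieldTheory

/-! ### Cartan's formula for forms on a normed space -/

section CartanFormula

variable {E : Type*} [NormedAddCommGroup E] [NormedSpace ℝ E] {s : Set E} {x : E}

theorem altDerivation_apply {k : ℕ} (A : E →L[ℝ] E) (w : E [⋀^Fin k]→L[ℝ] ℝ) (v : Fin k → E) :
    altDerivation A w v = ∑ i, w (Function.update v i (A (v i))) := rfl

theorem altDerivation_zero_form (A : E →L[ℝ] E) (w : E [⋀^Fin 0]→L[ℝ] ℝ) :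
    altDerivation A w = 0 := by
  ext v
  simp [altDerivation_apply]

/-- The infinitesimal action of an endomorphism in terms of the interior product. -/
theorem altDerivation_eq_alternatizeUncurryFin {k : ℕ} (A : E →L[ℝ] E)
    (w : E [⋀^Fin (k + 1)]→L[ℝ] ℝ) :
    altDerivation A w = ContinuousAlternatingMap.alternatizeUncurryFin (w.curryLeft.comp A) := by
  ext v
  rw [altDerivation_apply, ContinuousAlternatingMap.alternatizeUncurryFin_apply]
  refine Finset.sum_congr rfl fun i _ => ?_
  -- Moving the argument `A (v i)` from slot `i` to the front costs the sign `(-1)^i`, which is the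
  -- sign in the alternatization.
  rw [← Fin.insertNth_removeNth]
  exact w.toAlternatingMap.map_insertNth i (A (v i)) (i.removeNth v)

/-- `ContinuousAlternatingMap.curryLeft` as a continuous linear map. -/
def curryLeftCLM (E : Type*) [NormedAddCommGroup E] [NormedSpace ℝ E] (k : ℕ) :
    (E [⋀^Fin (k + 1)]→L[ℝ] ℝ) →L[ℝ] E →L[ℝ] E [⋀^Fin k]→L[ℝ] ℝ :=
  (ContinuousAlternatingMap.curryLeftLI (𝕜 := ℝ) (E := E) (F := ℝ)
    (n := k)).toContinuousLinearMap

theorem contDiff_curryLeftCLM (k : ℕ) : ContDiff ℝ ∞ (curryLeftCLM E k) :=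
  ContinuousLinearMap.contDiff (𝕜 := ℝ) (E := E [⋀^Fin (k + 1)]→L[ℝ] ℝ)
    (F := E →L[ℝ] E [⋀^Fin k]→L[ℝ] ℝ) (curryLeftCLM E k)

theorem hasFDerivAt_curryLeftCLM {k : ℕ} (w : E [⋀^Fin (k + 1)]→L[ℝ] ℝ) :
    HasFDerivAt (curryLeftCLM E k) (curryLeftCLM E k) w :=
  ContinuousLinearMap.hasFDerivAt (𝕜 := ℝ) (E := E [⋀^Fin (k + 1)]→L[ℝ] ℝ)
    (F := E →L[ℝ] E [⋀^Fin k]→L[ℝ] ℝ) (curryLeftCLM E k)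

/-- The interior product `w ↦ ι_u w` as a continuous linear map. -/
def interiorCLM (k : ℕ) (u : E) : (E [⋀^Fin (k + 1)]→L[ℝ] ℝ) →L[ℝ] E [⋀^Fin k]→L[ℝ] ℝ :=
  (curryLeftCLM E k).flip u

theorem interiorCLM_apply {k : ℕ} (u : E) (w : E [⋀^Fin (k + 1)]→L[ℝ] ℝ) :
    interiorCLM k u w = w.curryLeft u := rfl

/-- In the alternating sum over the arguments `u, v_0, …`, the term that feeds `u` to `f` is `f u`.
Every other term keeps `u` in the first slot of the form, and its sign is shifted by one because
`v_i` sits in position `i + 1`; these terms sum to minus the alternatization of `ι_u ∘ f`. Applied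
to `f = D w`, this is the algebraic half of Cartan's formula. -/
theorem curryLeft_alternatizeUncurryFin {k : ℕ} (f : E →L[ℝ] E [⋀^Fin (k + 1)]→L[ℝ] ℝ) (u : E) :
    (ContinuousAlternatingMap.alternatizeUncurryFin f).curryLeft u =
      f u - ContinuousAlternatingMap.alternatizeUncurryFin ((interiorCLM k u).comp f) := by
  ext v
  rw [ContinuousAlternatingMap.curryLeft_apply_apply,
    ContinuousAlternatingMap.alternatizeUncurryFin_apply, Fin.sum_univ_succ,
    ContinuousAlternatingMap.sub_apply,
    ContinuousAlternatingMap.alternatizeUncurryFin_apply, sub_eq_add_neg, ← Finset.sum_neg_distrib]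
  congr 1
  · simp
  · refine Finset.sum_congr rfl fun i _ => ?_
    have h : i.succ.removeNth (Matrix.vecCons u v) = Matrix.vecCons u (i.removeNth v) := by
      funext j
      refine Fin.cases ?_ (fun j => ?_) j <;> simp [Fin.removeNth]
    rw [h]
    simp [interiorCLM_apply, pow_succ]

/-- In degree `0` only the term `f u` of the alternating sum exists, so there is no correction. This
is `ι_ξ df = £_ξ f` for functions. -/
theorem curryLeft_alternatizeUncurryFin_zero (f : E →L[ℝ] E [⋀^Fin 0]→L[ℝ] ℝ) (u : E) :
    (ContinuousAlternatingMap.alternatizeUncurryFin f).curryLeft u = f u := by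
  ext v
  rw [ContinuousAlternatingMap.curryLeft_apply_apply,
    ContinuousAlternatingMap.alternatizeUncurryFin_apply]
  simp [Subsingleton.elim (Fin.removeNth 0 (Matrix.vecCons u v)) v]

/-- Cartan's formula in a vector space. -/
theorem extDerivWithin_curryLeft {k : ℕ} {w : E → E [⋀^Fin (k + 1)]→L[ℝ] ℝ} {ξ : E → E}
    (hw : DifferentiableWithinAt ℝ w s x) (hξ : DifferentiableWithinAt ℝ ξ s x)
    (hs : UniqueDiffWithinAt ℝ s x) :
    extDerivWithin (fun y => (w y).curryLeft (ξ y)) s x =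
      fderivWithin ℝ w s x (ξ x) + altDerivation (fderivWithin ℝ ξ s x) (w x) -
        (extDerivWithin w s x).curryLeft (ξ x) := by
  have h1 :=
    HasFDerivAt.comp_hasFDerivWithinAt (𝕜 := ℝ) (F := E [⋀^Fin (k + 1)]→L[ℝ] ℝ)
      (G := E →L[ℝ] E [⋀^Fin k]→L[ℝ] ℝ) (f := w) (g := curryLeftCLM E k) (g' := curryLeftCLM E k) x
      (hasFDerivAt_curryLeftCLM (w x)) hw.hasFDerivWithinAt
  -- Product rule: the derivative of `ι_ξ w` in the direction `u` is `ι_ξ (D w · u) + ι_{D ξ · u}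
  -- w`. Alternating the second summand over `u` gives `altDerivation`; alternating the first gives
  -- `D w · ξ - ι_ξ dw`.
  have h2 := (h1.clm_apply hξ.hasFDerivWithinAt).fderivWithin hs
  change fderivWithin ℝ (fun y => (w y).curryLeft (ξ y)) s x = _ at h2
  rw [extDerivWithin, h2, altDerivation_eq_alternatizeUncurryFin, extDerivWithin,
    curryLeft_alternatizeUncurryFin, ContinuousAlternatingMap.alternatizeUncurryFin_add]
  have h3 : ((curryLeftCLM E k).comp (fderivWithin ℝ w s x)).flip (ξ x) =
      (interiorCLM k (ξ x)).comp (fderivWithin ℝ w s x) := rfl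
  have h4 : (curryLeftCLM E k ∘ w) x = (w x).curryLeft := rfl
  rw [h3, h4]
  abel

theorem _root_.ContDiffOn.curryLeft {P : Type*} [NormedAddCommGroup P] [NormedSpace ℝ P]
    {t : Set P} {k : ℕ} {w : P → E [⋀^Fin (k + 1)]→L[ℝ] ℝ} {ξ : P → E}
    (hw : ContDiffOn ℝ ∞ w t) (hξ : ContDiffOn ℝ ∞ ξ t) :
    ContDiffOn ℝ ∞ (fun y => (w y).curryLeft (ξ y)) t := by
  have h : ContDiffOn ℝ ∞ (fun y => curryLeftCLM E k (w y)) t :=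
    (contDiff_curryLeftCLM k).comp_contDiffOn hw
  exact h.clm_apply hξ

end CartanFormula

/-! ### Forms and vector fields in preferred charts; Cartan's formula on manifolds -/

section FormCalculus

variable {E' : Type*} [NormedAddCommGroup E'] [NormedSpace ℝ E']
  {H' : Type*} [TopologicalSpace H'] {I' : ModelWithCorners ℝ E' H'}
  {M' : Type*} [TopologicalSpace M'] [ChartedSpace H' M']
  {E : Type*} [NormedAddCommGroup E] [NormedSpace ℝ E]
  {H : Type*} [TopologicalSpace H] {I : ModelWithCorners ℝ E H}
  {M : Type*} [TopologicalSpace M] [ChartedSpace H M]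

/-- The derivative of the inverse of the preferred chart around `x₀`, with values in the model. -/
def chartFrame (I : ModelWithCorners ℝ E H) (x₀ : M) (e : E) : E →L[ℝ] E :=
  mfderivWithin 𝓘(ℝ, E) I (extChartAt I x₀).symm (range I) e

theorem DForm.inChart_eq {k : ℕ} (w : DForm I M k) (x₀ : M) (e : E) :
    w.inChart x₀ e =
      (w ((extChartAt I x₀).symm e)).compContinuousLinearMap (chartFrame I x₀ e) := rfl

theorem DForm.inChart_apply {k : ℕ} (w : DForm I M k) (x₀ : M) (e : E) (v : Fin k → E) :
    w.inChart x₀ e v = w ((extChartAt I x₀).symm e) (fun i => chartFrame I x₀ e (v i)) := rfl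

theorem chartFrame_tangentMapAt [IsManifold I 1 M] {x₀ : M} {e : E}
    (he : e ∈ (extChartAt I x₀).target) (v : E) :
    chartFrame I x₀ e (tangentMapAt I 𝓘(ℝ, E) (extChartAt I x₀) ((extChartAt I x₀).symm e) v) =
      v :=
  DFunLike.congr_fun (mfderivWithin_extChartAt_symm_comp_mfderiv_extChartAt he) v

theorem tangentMapAt_chartFrame [IsManifold I 1 M] {x₀ : M} {e : E}
    (he : e ∈ (extChartAt I x₀).target) (v : E) :
    tangentMapAt I 𝓘(ℝ, E) (extChartAt I x₀) ((extChartAt I x₀).symm e) (chartFrame I x₀ e v) =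
      v :=
  DFunLike.congr_fun (mfderiv_extChartAt_comp_mfderivWithin_extChartAt_symm he) v

/-- The tangent space at `x` is identified with the model `E` by means of the preferred chart at `x`
itself. Hence `d` and the Lie derivative at `x` are simply their coordinate expressions in that
chart. -/
theorem tangentMapAt_extChartAt_self [IsManifold I 1 M] (x : M) :
    tangentMapAt I 𝓘(ℝ, E) (extChartAt I x) x = ContinuousLinearMap.id ℝ E :=
  mfderiv_extChartAt_self

theorem DForm.d_eq [IsManifold I 1 M] {k : ℕ} (w : DForm I M k) (x : M) :
    w.d x = extDerivWithin (w.inChart x) (range I) (extChartAt I x x) := by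
  rw [DForm.d, tangentMapAt_extChartAt_self]
  rfl

theorem DForm.lieDeriv_eq [IsManifold I 1 M] {k : ℕ} (ξ : VField I M) (w : DForm I M k) (x : M) :
    w.lieDeriv ξ x =
      fderivWithin ℝ (w.inChart x) (range I) (extChartAt I x x) (ξ.inChart x (extChartAt I x x)) +
        altDerivation (fderivWithin ℝ (ξ.inChart x) (range I) (extChartAt I x x))
          (w.inChart x (extChartAt I x x)) := by
  rw [DForm.lieDeriv, tangentMapAt_extChartAt_self]
  rfl

theorem VField.inChart_self [IsManifold I 1 M] (ξ : VField I M) (x : M) :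
    ξ.inChart x (extChartAt I x x) = ξ x := by
  -- The point obtained by applying the chart and its inverse to `x` is only provably equal to `x`,
  -- and `ξ y` lies in a space depending on `y`; hence the generalization over `y`.
  have h : ∀ y, y = x → tangentMapAt I 𝓘(ℝ, E) (extChartAt I x) y (ξ y) = ξ x := by
    rintro _ rfl
    rw [tangentMapAt_extChartAt_self]
    rfl
  exact h _ (extChartAt_to_inv x)

/-- The frame that pulls back the form undoes the chart derivative that pushes forward the vector
field, so contraction commutes with passing to coordinates. The two are mutually inverse only on the
target of the chart. -/
theorem DForm.inChart_interior [IsManifold I 1 M] {k : ℕ} (ξ : VField I M) (w : DForm I M (k + 1))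
    {x₀ : M} {e : E} (he : e ∈ (extChartAt I x₀).target) :
    (w.interior ξ).inChart x₀ e = (w.inChart x₀ e).curryLeft (ξ.inChart x₀ e) := by
  have h : chartFrame I x₀ e (ξ.inChart x₀ e) = ξ ((extChartAt I x₀).symm e) :=
    chartFrame_tangentMapAt he _
  rw [DForm.inChart_eq w, ContinuousAlternatingMap.curryLeft_compContinuousLinearMap, h]
  rfl

theorem DForm.inChart_sub {k : ℕ} (w w' : DForm I M k) (x₀ : M) :
    (w - w').inChart x₀ = w.inChart x₀ - w'.inChart x₀ := rfl

/-- The components of the vector field in every preferred chart are smooth. -/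
def VField.SmoothInCharts (ξ : VField I M) : Prop :=
  ∀ x₀ : M, ContDiffOn ℝ ∞ (ξ.inChart x₀) (extChartAt I x₀).target

theorem DForm.IsSmooth.sub {k : ℕ} {w w' : DForm I M k} (hw : w.IsSmooth) (hw' : w'.IsSmooth) :
    (w - w').IsSmooth := fun x₀ => (hw x₀).sub (hw' x₀)

theorem DForm.IsSmooth.neg {k : ℕ} {w : DForm I M k} (hw : w.IsSmooth) :
    (-w).IsSmooth := fun x₀ => (hw x₀).neg

theorem DForm.IsSmooth.interior [IsManifold I 1 M] {k : ℕ} {ξ : VField I M}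
    {w : DForm I M (k + 1)} (hw : w.IsSmooth) (hξ : ξ.SmoothInCharts) :
    (w.interior ξ).IsSmooth := fun x₀ =>
  (ContDiffOn.curryLeft (hw x₀) (hξ x₀)).congr fun _ he => DForm.inChart_interior ξ w he

theorem differentiableWithinAt_range_of_contDiffOn {G : Type*} [NormedAddCommGroup G]
    [NormedSpace ℝ G] {f : E → G} {x : M} (hf : ContDiffOn ℝ ∞ f (extChartAt I x).target) :
    DifferentiableWithinAt ℝ f (range I) (extChartAt I x x) :=
  ((hf _ (mem_extChartAt_target x)).differentiableWithinAt (by norm_num)).mono_of_mem_nhdsWithin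
    (extChartAt_target_mem_nhdsWithin x)

theorem uniqueDiffWithinAt_extChartAt (x : M) :
    UniqueDiffWithinAt ℝ (range I) (extChartAt I x x) :=
  I.uniqueDiffOn _ (mem_range_self _)

theorem DForm.d_sub [IsManifold I 1 M] {k : ℕ} {w w' : DForm I M k} (hw : w.IsSmooth)
    (hw' : w'.IsSmooth) : (w - w').d = w.d - w'.d := by
  funext x
  rw [Pi.sub_apply, DForm.d_eq, DForm.d_eq, DForm.d_eq, DForm.inChart_sub, extDerivWithin,
    fderivWithin_sub (uniqueDiffWithinAt_extChartAt x)
      (differentiableWithinAt_range_of_contDiffOn (hw x))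
      (differentiableWithinAt_range_of_contDiffOn (hw' x)),
    sub_eq_add_neg, ContinuousAlternatingMap.alternatizeUncurryFin_add, ← neg_one_smul ℝ
      (fderivWithin ℝ (w'.inChart x) (range I) (extChartAt I x x)),
    ContinuousAlternatingMap.alternatizeUncurryFin_smul, neg_one_smul, ← sub_eq_add_neg]
  rfl

theorem DForm.d_neg [IsManifold I 1 M] {k : ℕ} (w : DForm I M k) : (-w).d = -w.d := by
  funext x
  have h : (-w).inChart x = -w.inChart x := rfl
  rw [Pi.neg_apply, DForm.d_eq, DForm.d_eq, h, ← neg_one_smul ℝ (w.inChart x),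
    extDerivWithin_smul _ _ (uniqueDiffWithinAt_extChartAt x), neg_one_smul]

/-- Cartan's formula `d ι_ξ w = £_ξ w - ι_ξ d w`. -/
theorem DForm.d_interior [IsManifold I 1 M] {k : ℕ} {ξ : VField I M}
    {w : DForm I M (k + 1)} (hw : w.IsSmooth) (hξ : ξ.SmoothInCharts) :
    (w.interior ξ).d = w.lieDeriv ξ - w.d.interior ξ := by
  funext x
  -- The coordinate formula for `ι_ξ w` holds only on the chart target, but this is a neighbourhood
  -- within `range I`, which suffices for the derivative.
  have h : (w.interior ξ).inChart x =ᶠ[𝓝[range I] (extChartAt I x x)]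
      fun e => (w.inChart x e).curryLeft (ξ.inChart x e) := by
    filter_upwards [extChartAt_target_mem_nhdsWithin x] with e he
    exact DForm.inChart_interior ξ w he
  rw [Pi.sub_apply, DForm.d_eq, h.extDerivWithin_eq_of_mem (mem_range_self _),
    extDerivWithin_curryLeft (differentiableWithinAt_range_of_contDiffOn (hw x))
      (differentiableWithinAt_range_of_contDiffOn (hξ x)) (uniqueDiffWithinAt_extChartAt x),
    DForm.lieDeriv_eq, DForm.interior, DForm.d_eq, VField.inChart_self]

/-- Cartan's formula for functions. -/
theorem DForm.interior_d_zero_form [IsManifold I 1 M] (ξ : VField I M) (w : DForm I M 0) :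
    w.d.interior ξ = w.lieDeriv ξ := by
  funext x
  rw [DForm.lieDeriv_eq, altDerivation_zero_form, add_zero, VField.inChart_self]
  change (w.d x).curryLeft _ = _
  rw [DForm.d_eq]
  exact curryLeft_alternatizeUncurryFin_zero _ _

theorem DForm.pullback_sub {k : ℕ} (f : M → M') (w w' : DForm I' M' k) :
    DForm.pullback (I := I) f (w - w') = DForm.pullback f w - DForm.pullback f w' := rfl

/-- `(f^* w)(ξ, …) = w (Tf ξ, Tf …)`, and `Tf ξ = ξ' ∘ f` for related fields. It is used with `f =
i_B` and `ξ` the restriction of `ξ'` to `B`. -/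
theorem DForm.pullback_interior {k : ℕ} {f : M → M'} {ξ : VField I M} {ξ' : VField I' M'}
    (h : ∀ x, tangentMapAt I I' f x (ξ x) = ξ' (f x)) (w : DForm I' M' (k + 1)) :
    DForm.pullback (I := I) f (w.interior ξ') = (DForm.pullback f w).interior ξ := by
  funext x
  refine Eq.trans ?_ (ContinuousAlternatingMap.curryLeft_compContinuousLinearMap (E := E)
    (w (f x)) (tangentMapAt I I' f x) (ξ x)).symm
  rw [h]
  rfl

/-- Smoothness of a section of `TM` is smoothness of its fibre component in the trivialization
around `x₀`, and that trivialization acts on fibres by the derivative of the preferred chart at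
`x₀`. -/
theorem VField.IsSmooth.smoothInCharts [IsManifold I ∞ M] {ξ : VField I M} (hξ : ξ.IsSmooth) :
    ξ.SmoothInCharts := by
  intro x₀ e he
  have hx := (extChartAt I x₀).map_target he
  rw [extChartAt_source] at hx
  have h1 : ContMDiffAt I 𝓘(ℝ, E) ∞
      (fun x => (trivializationAt E (TangentSpace I) x₀ ⟨x, ξ x⟩).2) ((extChartAt I x₀).symm e) :=
    (Bundle.Trivialization.contMDiffAt_section_iff (trivializationAt E (TangentSpace I) x₀)
      (by simpa using hx)).1 (hξ _)
  have h2 := h1.comp_contMDiffWithinAt e ((contMDiffOn_extChartAt_symm (n := ∞) x₀) e he)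
  refine h2.contDiffWithinAt.congr_of_mem (fun e' he' => ?_) he
  have hx' := (extChartAt I x₀).map_target he'
  rw [extChartAt_source] at hx'
  have h3 := DFunLike.congr_fun (TangentBundle.continuousLinearMapAt_trivializationAt hx')
    (ξ ((extChartAt I x₀).symm e'))
  refine h3.symm.trans ?_
  rw [Bundle.Trivialization.continuousLinearMapAt_apply, Bundle.Trivialization.linearMapAt_apply,
    if_pos (by simpa using hx')]
  rfl

end FormCalculus

/-! ### Smoothness of the restricted vector field, and exactness on the boundary -/

section TangentFields

variable {E' : Type*} [NormedAddCommGroup E'] [NormedSpace ℝ E']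
  {H' : Type*} [TopologicalSpace H'] {I' : ModelWithCorners ℝ E' H'}
  {M' : Type*} [TopologicalSpace M'] [ChartedSpace H' M']
  {E : Type*} [NormedAddCommGroup E] [NormedSpace ℝ E]
  {H : Type*} [TopologicalSpace H] {I : ModelWithCorners ℝ E H}
  {M : Type*} [TopologicalSpace M] [ChartedSpace H M]

/-- The solution `u` of a linear system `A u = c` with smooth coefficients and injective `A` is
smooth. -/
theorem contDiffWithinAt_of_injective {P : Type*} [NormedAddCommGroup P] [NormedSpace ℝ P]
    [FiniteDimensional ℝ E] [FiniteDimensional ℝ E'] {A : P → E →L[ℝ] E'} {u : P → E} {c : P → E'}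
    {t : Set P} {p : P} (hp : p ∈ t) (hA : ContDiffWithinAt ℝ ∞ A t p)
    (hc : ContDiffWithinAt ℝ ∞ c t p) (hinj : Function.Injective (A p))
    (h : ∀ᶠ q in 𝓝[t] p, A q (u q) = c q) : ContDiffWithinAt ℝ ∞ u t p := by
  have : CompleteSpace E := FiniteDimensional.complete ℝ E
  -- `Q ∘ A q` is the identity at `q = p`, hence invertible for `q` near `p`. There `u q = (Q ∘ A
  -- q)⁻¹ (Q (c q))`, and inversion is smooth near the identity.
  set Q := leftInv (A p) hinj
  have h1 : ContDiffWithinAt ℝ ∞ (fun q => Q.comp (A q)) t p := contDiffWithinAt_const.clm_comp hA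
  have h2 : Q.comp (A p) = ((ContinuousLinearEquiv.refl ℝ E : E ≃L[ℝ] E) : E →L[ℝ] E) := by
    ext v
    exact leftInv_apply (A p) hinj v
  have h3 : ContDiffAt ℝ ∞ (ContinuousLinearMap.inverse : (E →L[ℝ] E) → E →L[ℝ] E)
      (Q.comp (A p)) := by
    rw [h2]
    exact contDiffAt_map_inverse _
  have h4 : ContDiffWithinAt ℝ ∞
      (fun q => ContinuousLinearMap.inverse (Q.comp (A q)) (Q (c q))) t p :=
    (ContDiffAt.comp_contDiffWithinAt (f := fun q => Q.comp (A q)) p h3 h1).clm_apply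
      (Q.contDiff.comp_contDiffWithinAt hc)
  have h5 : ∀ᶠ q in 𝓝[t] p, (Q.comp (A q)).IsInvertible := by
    refine h1.continuousWithinAt.eventually (p := fun T => T.IsInvertible) ?_
    beta_reduce
    rw [h2]
    exact ContinuousLinearEquiv.nhds _
  have h6 : u =ᶠ[𝓝[t] p] fun q => ContinuousLinearMap.inverse (Q.comp (A q)) (Q (c q)) := by
    filter_upwards [h, h5] with q hq hq'
    symm
    rw [hq'.inverse_apply_eq, ← hq]
    rfl
  exact h4.congr_of_eventuallyEq_of_mem h6 hp

/-- A vector field on a submanifold is smooth if it is the restriction of a smooth vector field. -/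
theorem VField.SmoothInCharts.of_related [FiniteDimensional ℝ E] [FiniteDimensional ℝ E']
    [IsManifold I ∞ M] [IsManifold I' ∞ M'] {f : M → M'} (hf : ContMDiff I I' ∞ f)
    (hinj : ∀ x, Function.Injective (tangentMapAt I I' f x)) {ξ : VField I M} {ξ' : VField I' M'}
    (hξ' : ξ'.SmoothInCharts) (h : ∀ x, tangentMapAt I I' f x (ξ x) = ξ' (f x)) :
    ξ.SmoothInCharts := by
  intro x₀ e₁ he₁
  set φ := extChartAt I x₀ with hφ
  -- The chart on `M'` is centred at the image of the point under study rather than at `f x₀`, so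
  -- that the image lies in its source and its derivative there is the identity.
  set ψ := extChartAt I' (f (φ.symm e₁)) with hψ
  have hrange : range I ∈ 𝓝[φ.target] e₁ :=
    Filter.mem_of_superset self_mem_nhdsWithin (extChartAt_target_subset_range x₀)
  have htarget : φ.target ∈ 𝓝[range I] e₁ := extChartAt_target_mem_nhdsWithin_of_mem he₁
  have hsymm : ContMDiffWithinAt 𝓘(ℝ, E) I ∞ φ.symm (range I) e₁ :=
    contMDiffWithinAt_extChartAt_symm_range x₀ he₁
  have hfs : ContMDiffWithinAt 𝓘(ℝ, E) I' ∞ (f ∘ φ.symm) (range I) e₁ :=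
    (hf _).comp_contMDiffWithinAt e₁ hsymm
  have hcoord : ContDiffWithinAt ℝ ∞ (fun e => ψ (f (φ.symm e))) (range I) e₁ :=
    ((contMDiffAt_extChartAt (x := f (φ.symm e₁))).comp_contMDiffWithinAt e₁ hfs).contDiffWithinAt
  have hmem : ∀ᶠ e in 𝓝[range I] e₁, f (φ.symm e) ∈ ψ.source :=
    hfs.continuousWithinAt (extChartAt_source_mem_nhds (I := I') (f (φ.symm e₁)))
  have hderiv : ∀ e ∈ φ.target, f (φ.symm e) ∈ ψ.source →
      fderivWithin ℝ (fun e => ψ (f (φ.symm e))) (range I) e =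
        (tangentMapAt I' 𝓘(ℝ, E') ψ (f (φ.symm e))).comp
          ((tangentMapAt I I' f (φ.symm e)).comp (chartFrame I x₀ e)) := by
    intro e he hes
    have h1 := (mdifferentiableWithinAt_extChartAt_symm (I := I) he).hasMFDerivWithinAt
    have h2 := ((hf (φ.symm e)).mdifferentiableAt (by norm_num)).hasMFDerivAt
    rw [hψ, extChartAt_source] at hes
    have h3 := (mdifferentiableAt_extChartAt (I := I') hes).hasMFDerivAt
    have h4 := (h3.comp_hasMFDerivWithinAt e (h2.comp_hasMFDerivWithinAt e h1))
    have h5 : HasFDerivWithinAt (fun e => ψ (f (φ.symm e)))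
        ((tangentMapAt I' 𝓘(ℝ, E') ψ (f (φ.symm e))).comp
          ((tangentMapAt I I' f (φ.symm e)).comp (chartFrame I x₀ e))) (range I) e :=
      hasMFDerivWithinAt_iff_hasFDerivWithinAt.1 h4
    exact h5.fderivWithin (I.uniqueDiffOn _ (extChartAt_target_subset_range x₀ he))
  -- In coordinates, relatedness reads `D f · ξ = ξ' ∘ f`: a linear system for the components of
  -- `ξ`, with smooth coefficients and injective matrix `D f`.
  refine contDiffWithinAt_of_injective (A := fderivWithin ℝ (fun e => ψ (f (φ.symm e))) (range I))
    (c := fun e => ξ'.inChart (f (φ.symm e₁)) (ψ (f (φ.symm e)))) he₁ ?_ ?_ ?_ ?_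
  · exact (hcoord.fderivWithin_right I.uniqueDiffOn (m := ∞) (by norm_num)
      (extChartAt_target_subset_range x₀ he₁)).mono (extChartAt_target_subset_range x₀)
  · refine ContDiffWithinAt.comp_of_preimage_mem_nhdsWithin (t := ψ.target) e₁
      (hξ' _ _ (mem_extChartAt_target _)) (hcoord.mono (extChartAt_target_subset_range x₀)) ?_
    filter_upwards [hmem.filter_mono (nhdsWithin_mono _ (extChartAt_target_subset_range x₀))]
      with e he
    exact ψ.map_source he
  · rw [hderiv e₁ he₁ (mem_extChartAt_source _), hψ, tangentMapAt_extChartAt_self]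
    exact (hinj _).comp (Function.LeftInverse.injective (tangentMapAt_chartFrame he₁))
  · filter_upwards [hmem.filter_mono (nhdsWithin_mono _ (extChartAt_target_subset_range x₀)),
      self_mem_nhdsWithin] with e hes he
    rw [hderiv e he hes]
    have h1 : chartFrame I x₀ e (ξ.inChart x₀ e) = ξ (φ.symm e) := chartFrame_tangentMapAt he _
    have h2 : ∀ y, y = f (φ.symm e) →
        tangentMapAt I' 𝓘(ℝ, E') ψ (f (φ.symm e)) (ξ' (f (φ.symm e))) =
          tangentMapAt I' 𝓘(ℝ, E') ψ y (ξ' y) := by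
      rintro _ rfl
      rfl
    rw [ContinuousLinearMap.comp_apply, ContinuousLinearMap.comp_apply, h1, h]
    exact h2 _ (ψ.left_inv hes)

/-- If `£_ξ w = 0` then `ι_ξ dw = -d ι_ξ w` is exact. -/
theorem DForm.IsSmooth.isExact_interior_d_sub [IsManifold I ∞ M] {k : ℕ} {w β : DForm I M k}
    {ξ : VField I M} (hw : w.IsSmooth) (hξ : ξ.SmoothInCharts) (h : w.lieDeriv ξ = 0)
    (hβ : β.IsExact) : (w.d.interior ξ - β).IsExact := by
  -- For a function `w`, exactness means vanishing, and `ι_ξ dw = £_ξ w = 0`. In positive degree,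
  -- with `β = dγ`, the primitive is `-ι_ξ w - γ`.
  cases k with
  | zero =>
    have hβ' : β = 0 := hβ
    change w.d.interior ξ - β = 0
    rw [hβ', DForm.interior_d_zero_form, h, sub_zero]
  | succ k =>
    obtain ⟨γ, hγ, rfl⟩ := hβ
    refine ⟨-(w.interior ξ) - γ, (hw.interior hξ).neg.sub hγ, ?_⟩
    rw [DForm.d_sub (hw.interior hξ).neg hγ, DForm.d_neg, DForm.d_interior hw hξ, h,
      zero_sub, neg_neg]

end TangentFields

/-! ### Noether's theorem for a general smooth form `Θ` -/

section Noether

variable {E : Type*} [NormedAddCommGroup E] [NormedSpace ℝ E]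
  {H : Type*} [TopologicalSpace H] {I : ModelWithCorners ℝ E H}
  {X : Type*} [TopologicalSpace X] [ChartedSpace H X]
  {EW : Type*} [NormedAddCommGroup EW] [NormedSpace ℝ EW] [FiniteDimensional ℝ EW]
  {HW : Type*} [TopologicalSpace HW] {IW : ModelWithCorners ℝ EW HW}
  {W : Type*} [TopologicalSpace W] [ChartedSpace HW W] [IsManifold IW ∞ W]
  {EB : Type*} [NormedAddCommGroup EB] [NormedSpace ℝ EB] [FiniteDimensional ℝ EB]
  {HB : Type*} [TopologicalSpace HB] {IB : ModelWithCorners ℝ EB HB}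
  {B : Type*} [TopologicalSpace B] [ChartedSpace HB B] [IsManifold IB ∞ B]
  {n : ℕ} {p : W → X} {Θ : DForm IW W (n + 1)} {bc : BoundaryCondition I p Θ IB B}
  {ξ : VField IW W} {α : DForm IW W n}

/-- By Cartan's formula the left side is `£_ξ Θ - ι_ξ dΘ - dα`, and `£_ξ Θ = dα` cancels the last
term, leaving `ι_ξ Ω` before any field equation is used. -/
theorem IsCartanSymmetry.d_interior_sub (hΘ : Θ.IsSmooth) (h : IsCartanSymmetry bc ξ α) :
    (Θ.interior ξ - α).d = DForm.interior ξ (-Θ.d) := by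
  have hξ := h.smooth_field.smoothInCharts
  rw [DForm.d_sub (hΘ.interior hξ) h.smooth_form, DForm.d_interior hΘ hξ, h.lieDeriv_eq]
  funext x
  change α.d x - (Θ.d x).curryLeft (ξ x : EW) - α.d x = (-Θ.d x).curryLeft (ξ x : EW)
  rw [sub_sub_cancel_left]
  rfl

/-- The field equations hold for all smooth test fields; the symmetry `ξ` is one of them. -/
theorem IsCartanSymmetry.isPreservedQuantity (hΘ : Θ.IsSmooth) (h : IsCartanSymmetry bc ξ α) :
    IsPreservedQuantity I p Θ (Θ.interior ξ - α) where
  smooth := (hΘ.interior h.smooth_field.smoothInCharts).sub h.smooth_form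
  preserved σ hσ := by
    rw [h.d_interior_sub hΘ]
    exact hσ.equation ξ h.smooth_field

/-- Since `ξ` is tangent to `B`, the contraction commutes with `i_B^*`, and `i_B^* Θ = dΠ` reduces
the claim to `ι_{ξ_B} dΠ - i_B^* α`. The field `ξ_B` is only given pointwise; as `i_B` is an
immersion, it inherits smoothness from `ξ`. -/
theorem IsCartanSymmetry.isExact (h : IsCartanSymmetry bc ξ α) :
    (DForm.pullback (I := IB) bc.incl (Θ.interior ξ - α)).IsExact := by
  obtain ⟨ξB, hξB, hΦ⟩ := h.tangent_boundary
  have hsmooth : ξB.SmoothInCharts := .of_related bc.smooth_incl bc.injective_tangentMapAt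
    h.smooth_field.smoothInCharts hξB
  rw [DForm.pullback_sub, DForm.pullback_interior hξB, bc.d_potential]
  exact bc.smooth_potential.isExact_interior_d_sub hsmooth hΦ h.exact_on_boundary

end Noether

/-! ### Smooth families of alternating forms -/

section Evaluation

variable {W : Type*} [NormedAddCommGroup W] [NormedSpace ℝ W]
  {P : Type*} [NormedAddCommGroup P] [NormedSpace ℝ P] {t : Set P}

/-- The evaluation of alternating forms at fixed vectors. -/
def evalCLM {k : ℕ} (v : Fin k → W) : (W [⋀^Fin k]→L[ℝ] ℝ) →L[ℝ] ℝ :=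
  ContinuousAlternatingMap.apply ℝ W ℝ v

theorem contDiff_evalCLM {k : ℕ} (v : Fin k → W) : ContDiff ℝ ∞ (evalCLM v) :=
  ContinuousLinearMap.contDiff (𝕜 := ℝ) (E := W [⋀^Fin k]→L[ℝ] ℝ) (F := ℝ) (evalCLM v)

/-- A smooth family of forms, applied to smooth families of vectors, is smooth. -/
theorem contDiffOn_alternating_apply {k : ℕ} {w : P → W [⋀^Fin k]→L[ℝ] ℝ} {v : Fin k → P → W}
    (hw : ContDiffOn ℝ ∞ w t) (hv : ∀ i, ContDiffOn ℝ ∞ (v i) t) :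
    ContDiffOn ℝ ∞ (fun p => w p (fun i => v i p)) t := by
  -- Induction on the degree: the first vector is absorbed into the form by an interior product.
  induction k with
  | zero =>
    refine ((contDiff_evalCLM (W := W) Fin.elim0).comp_contDiffOn hw).congr fun p _ => ?_
    exact congrArg (w p) (Subsingleton.elim _ _)
  | succ k ih =>
    refine (ih (ContDiffOn.curryLeft hw (hv 0)) fun i => hv i.succ).congr fun p _ => ?_
    rw [ContinuousAlternatingMap.curryLeft_apply_apply]
    congr 1
    funext i
    refine Fin.cases ?_ (fun i => ?_) i <;> simp

/-- A family of forms on a finite-dimensional space is smooth if its values on fixed vectors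
are. -/
theorem contDiffOn_alternating_of_apply [FiniteDimensional ℝ W] {k : ℕ}
    {w : P → W [⋀^Fin k]→L[ℝ] ℝ} (hw : ∀ v, ContDiffOn ℝ ∞ (fun p => w p v) t) :
    ContDiffOn ℝ ∞ w t := by
  set b := Module.finBasis ℝ W
  -- A form is determined by its values on tuples of basis vectors. This embeds the forms linearly
  -- in a finite-dimensional function space, and a linear left inverse `r` recovers the form
  -- smoothly from those values.
  let j : (W [⋀^Fin k]→L[ℝ] ℝ) →ₗ[ℝ] ((Fin k → Fin (Module.finrank ℝ W)) → ℝ) :=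
    { toFun := fun w s => w (fun i => b (s i))
      map_add' := fun _ _ => rfl
      map_smul' := fun _ _ => rfl }
  have hj : Function.Injective j := by
    intro w w' h
    apply ContinuousAlternatingMap.toAlternatingMap_injective
    refine AlternatingMap.coe_multilinearMap_injective ?_
    exact Module.Basis.ext_multilinear (fun _ => b) fun s => congrFun h s
  obtain ⟨r, hr⟩ := j.exists_leftInverse_of_injective (LinearMap.ker_eq_bot.2 hj)
  have h1 : ContDiff ℝ ∞ (LinearMap.toContinuousLinearMap r) :=
    ContinuousLinearMap.contDiff (𝕜 := ℝ) (E := (Fin k → Fin (Module.finrank ℝ W)) → ℝ)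
      (F := W [⋀^Fin k]→L[ℝ] ℝ) _
  have h2 : ContDiffOn ℝ ∞ (fun p => j (w p)) t := contDiffOn_pi.2 fun s => hw _
  refine (h1.comp_contDiffOn h2).congr fun p _ => ?_
  exact (LinearMap.congr_fun hr (w p)).symm

end Evaluation

/-! ### Expressions of forms in arbitrary charts of the maximal atlas -/

section FormsInCharts

variable {E : Type*} [NormedAddCommGroup E] [NormedSpace ℝ E]
  {H : Type*} [TopologicalSpace H] {I : ModelWithCorners ℝ E H}
  {M : Type*} [TopologicalSpace M] [ChartedSpace H M]

/-- The chart target is a neighbourhood of each of its points within `range I`, so smoothness on it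
passes to `range I`, where derivatives are unique even at the boundary. This supplies the
derivatives of `L`. -/
theorem contDiffOn_fderivWithin_range {G : Type*} [NormedAddCommGroup G] [NormedSpace ℝ G]
    {f : E → G} {x₀ : M} (hf : ContDiffOn ℝ ∞ f (extChartAt I x₀).target) :
    ContDiffOn ℝ ∞ (fderivWithin ℝ f (range I)) (extChartAt I x₀).target := by
  intro e he
  have h : ContDiffWithinAt ℝ ∞ f (range I) e :=
    (hf e he).mono_of_mem_nhdsWithin (extChartAt_target_mem_nhdsWithin_of_mem he)
  exact (h.fderivWithin_right I.uniqueDiffOn (m := ∞) (by norm_num)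
    (extChartAt_target_subset_range x₀ he)).mono (extChartAt_target_subset_range x₀)

/-- The expression of a form in an arbitrary chart. -/
def DForm.inAtlasChart {k : ℕ} (w : DForm I M k) (φ : OpenPartialHomeomorph M H) (q : E) :
    E [⋀^Fin k]→L[ℝ] ℝ :=
  (w (φ.symm (I.symm q))).compContinuousLinearMap (tangentMapAt I I φ.symm (I.symm q))

theorem DForm.inAtlasChart_apply {k : ℕ} (w : DForm I M k) {φ : OpenPartialHomeomorph M H} {x : M}
    (hx : x ∈ φ.source) (v : Fin k → E) :
    w.inAtlasChart φ (I (φ x)) v = w x (fun i => tangentMapAt I I φ.symm (φ x) (v i)) := by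
  change w (φ.symm (I.symm (I (φ x))))
    (fun i => tangentMapAt I I φ.symm (I.symm (I (φ x))) (v i)) = _
  rw [I.left_inv, φ.left_inv hx]

/-- Smoothness of a form refers to preferred charts, while `η` will be read in the base charts of
adapted pairs. Near each point the expression in `φ` is the pullback, by the transition map, of the
expression in the preferred chart there. -/
theorem DForm.IsSmooth.contDiffOn_inAtlasChart [FiniteDimensional ℝ E] [IsManifold I ∞ M] {k : ℕ}
    {w : DForm I M k} (hw : w.IsSmooth) {φ : OpenPartialHomeomorph M H}
    (hφ : φ ∈ IsManifold.maximalAtlas I ∞ M) :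
    ContDiffOn ℝ ∞ (w.inAtlasChart φ) (I.symm ⁻¹' φ.target ∩ range I) := by
  refine contDiffOn_alternating_of_apply fun v => ?_
  rintro _ ⟨hq, p, rfl⟩
  rw [mem_preimage, I.left_inv] at hq
  obtain ⟨x₁, hx₁, rfl⟩ : ∃ x, x ∈ φ.source ∧ φ x = p := ⟨_, φ.map_target hq, φ.right_inv hq⟩
  set ψ := chartAt H x₁
  have hψ : ψ ∈ IsManifold.maximalAtlas I ∞ M := IsManifold.chart_mem_maximalAtlas x₁
  have h1 : ContDiffOn ℝ ∞ (fun q => w.inChart x₁ (transition I φ ψ q)) (overlap I φ ψ) := by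
    refine (hw x₁).comp (contDiffOn_transition hφ hψ) ?_
    rintro _ ⟨hq, p, rfl⟩
    rw [mem_preimage, I.left_inv] at hq
    have h : φ.symm p ∈ ψ.source := by simpa using hq.2
    have h' : transition I φ ψ (I p) = extChartAt I x₁ (φ.symm p) := by simp [transition, ψ]
    rw [h']
    exact (extChartAt I x₁).map_source (by rwa [extChartAt_source])
  have h2 : ContDiffOn ℝ ∞ (fun q => w.inChart x₁ (transition I φ ψ q)
      (fun i => jac I φ ψ q (v i))) (overlap I φ ψ) :=
    contDiffOn_alternating_apply h1 fun i => (contDiffOn_jac hφ hψ).clm_apply contDiffOn_const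
  have hmem : overlap I φ ψ ∈ 𝓝[I.symm ⁻¹' φ.target ∩ range I] (I (φ x₁)) := by
    have ho : IsOpen (I.symm ⁻¹' (φ.symm.trans ψ).source) :=
      (φ.symm.trans ψ).open_source.preimage I.continuous_symm
    filter_upwards [self_mem_nhdsWithin, mem_nhdsWithin_of_mem_nhds
      (ho.mem_nhds (mem_overlap (I := I) hx₁ (mem_chart_source H x₁)).1)] with q hq hq'
    exact ⟨hq', hq.2⟩
  have h3 : ContDiffWithinAt ℝ ∞ (fun q => w.inChart x₁ (transition I φ ψ q)
      (fun i => jac I φ ψ q (v i))) (I.symm ⁻¹' φ.target ∩ range I) (I (φ x₁)) :=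
    (h2 _ (mem_overlap hx₁ (mem_chart_source H x₁))).mono_of_mem_nhdsWithin hmem
  refine h3.congr_of_eventuallyEq_of_mem ?_ ⟨by rwa [mem_preimage, I.left_inv], mem_range_self _⟩
  filter_upwards [hmem]
  rintro _ ⟨hq, p, rfl⟩
  rw [mem_preimage, I.left_inv] at hq
  obtain ⟨x, hx, rfl⟩ : ∃ x, x ∈ φ.source ∧ φ x = p :=
    ⟨_, φ.map_target (by simpa using hq.1), φ.right_inv (by simpa using hq.1)⟩
  have hx' : x ∈ ψ.source := by simpa [hx] using hq.2
  rw [w.inAtlasChart_apply hx, transition_apply hx]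
  change _ = w ((extChartAt I x₁).symm (extChartAt I x₁ x))
    (fun i => chartFrame I x₁ (extChartAt I x₁ x) (jac I φ ψ (I (φ x)) (v i)))
  have hx'' : x ∈ (extChartAt I x₁).source := by rwa [extChartAt_source]
  rw [(extChartAt I x₁).left_inv hx'']
  congr 1
  funext i
  -- The transition derivative carries `v i` to the image under `Tψ` of the tangent vector with
  -- `φ`-coordinates `v i`; the frame of the preferred chart then recovers that vector.
  have h4 := jac_comp hφ hψ hx hx' (tangentMapAt I I φ.symm (φ x) (v i))
  rw [tangentMapAt_chart_symm hφ hx] at h4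
  rw [h4]
  have h5 : tangentMapAt I 𝓘(ℝ, E) (extChartAt I x₁) x = tangentMapAt I I ψ x :=
    (hasMFDerivAt_extChartAt hx').mfderiv
  rw [← h5]
  exact (DFunLike.congr_fun (mfderivWithin_extChartAt_symm_comp_mfderiv_extChartAt' hx'') _).symm

end FormsInCharts

/-! ### The bundle projection in induced coordinates -/

section TotalSpace

variable {E : Type*} [NormedAddCommGroup E] [NormedSpace ℝ E]
  {H : Type*} [TopologicalSpace H] {I : ModelWithCorners ℝ E H}
  {M : Type*} [TopologicalSpace M] [ChartedSpace H M] [IsManifold I ∞ M]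
  {G : Type*} [NormedAddCommGroup G] [NormedSpace ℝ G]
  {Fib : M → Type*} {ι : Type*} (c : FibreCharts I G Fib ι)

theorem tangentMapAt_chartFrame_of_mem {x₀ x : M} (hx : x ∈ (extChartAt I x₀).source) (v : E) :
    tangentMapAt I 𝓘(ℝ, E) (extChartAt I x₀) x (chartFrame I x₀ (extChartAt I x₀ x) v) = v :=
  DFunLike.congr_fun (mfderiv_extChartAt_comp_mfderivWithin_extChartAt_symm' hx) v

theorem Total.mem_extChartAt_source {z₀ z : Total c} :
    z ∈ (extChartAt (I.prod 𝓘(ℝ, G)) z₀).source ↔ z.pt ∈ (c.base (c.idx z₀.pt)).source := by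
  rw [extChartAt_source]
  rfl

theorem Total.extChartAt_apply (z₀ z : Total c) :
    extChartAt (I.prod 𝓘(ℝ, G)) z₀ z =
      (I (c.base (c.idx z₀.pt) z.pt), c.coord (c.idx z₀.pt) z) := rfl

/-- In the coordinates induced on the total space, the bundle projection is the projection to the
first factor. -/
theorem Total.tangentMapAt_base_pt {z₀ z : Total c}
    (hz : z.pt ∈ (c.base (c.idx z₀.pt)).source) (V : E × G) :
    tangentMapAt I I (c.base (c.idx z₀.pt)) z.pt
        (tangentMapAt (I.prod 𝓘(ℝ, G)) I Total.pt z V) =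
      (tangentMapAt (I.prod 𝓘(ℝ, G)) 𝓘(ℝ, E × G) (extChartAt (I.prod 𝓘(ℝ, G)) z₀) z V).1 := by
  have h1 := ((Total.contMDiff_pt c z).mdifferentiableAt (by norm_num)).hasMFDerivAt
  have h2 := ((contMDiffAt_of_mem_maximalAtlas (c.base_mem (c.idx z₀.pt)) hz).mdifferentiableAt
    (by norm_num)).hasMFDerivAt
  -- `h3` and `h5` differentiate the same map, the first component of the chart of the total space:
  -- once through the projection to the base, once through the chart. The model map `I` has the
  -- identity as derivative.
  have h3 := (I.hasMFDerivAt (x := c.base (c.idx z₀.pt) z.pt)).comp z (h2.comp z h1)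
  have hz' : z ∈ (chartAt (ModelProd H G) z₀).source := hz
  have h4 := (mdifferentiableAt_extChartAt (I := I.prod 𝓘(ℝ, G)) hz').hasMFDerivAt
  have h5 := ((ContinuousLinearMap.fst ℝ E G).hasFDerivAt
    (x := extChartAt (I.prod 𝓘(ℝ, G)) z₀ z)).hasMFDerivAt.comp z h4
  exact DFunLike.congr_fun (hasMFDerivAt_unique h3 h5) V

/-- A tangent vector of the total space with coordinates `v` projects to the base vector with
coordinates `v.1`. Both Cartan forms are evaluated in charts through this fact. -/
theorem Total.tangentMapAt_base_pt_chartFrame {z₀ z : Total c}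
    (hz : z.pt ∈ (c.base (c.idx z₀.pt)).source) (v : E × G) :
    tangentMapAt I I (c.base (c.idx z₀.pt)) z.pt
        (tangentMapAt (I.prod 𝓘(ℝ, G)) I Total.pt z
          (chartFrame (I.prod 𝓘(ℝ, G)) z₀ (extChartAt (I.prod 𝓘(ℝ, G)) z₀ z) v)) = v.1 := by
  rw [Total.tangentMapAt_base_pt c hz,
    tangentMapAt_chartFrame_of_mem ((Total.mem_extChartAt_source c).2 hz)]

end TotalSpace

/-! ### Smoothness of `Θ_h` -/

section Hamiltonian

variable {E : Type*} [NormedAddCommGroup E] [NormedSpace ℝ E] [FiniteDimensional ℝ E]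
  {H : Type*} [TopologicalSpace H] {I : ModelWithCorners ℝ E H}
  {F : Type*} [NormedAddCommGroup F] [NormedSpace ℝ F] [FiniteDimensional ℝ F]
  {X : Type*} [TopologicalSpace X] [ChartedSpace H X]
  {Y : Type*} [TopologicalSpace Y] [ChartedSpace (ModelProd H F) Y]

namespace Fibration

variable {π : Fibration I F X Y} [IsManifold I ∞ X] [IsManifold (I.prod 𝓘(ℝ, F)) ∞ Y]

theorem IsHamiltonian.pt_apply {k : ℕ} {h : π.DualJet k → π.FormBundle k 2}
    (hh : π.IsHamiltonian h) (z : π.DualJet k) : (h z).pt = z.pt :=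
  congrArg Total.pt (hh.toDual_apply z)

/-- As a section of `μ`, `h` covers the identity of `Y`; the chain rule for `ν ∘ h` then removes
`Th` from the Liouville form, so `Θ_h` depends on `h` but not on its derivative. -/
theorem IsHamiltonian.tangentMapAt_pt {k : ℕ} {h : π.DualJet k → π.FormBundle k 2}
    (hh : π.IsHamiltonian h) (z : π.DualJet k)
    (V : (E × F) × SemiFormsQuot (modelVertical E F) k) :
    tangentMapAt (π.formModel k 2) (I.prod 𝓘(ℝ, F)) Total.pt (h z)
        (tangentMapAt (π.dualModel k) (π.formModel k 2) h z V) =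
      tangentMapAt (π.dualModel k) (I.prod 𝓘(ℝ, F)) Total.pt z V := by
  have h1 := ((hh.smooth z).mdifferentiableAt (by norm_num)).hasMFDerivAt
  have h2 := ((Total.contMDiff_pt (π.formCharts k 2) (h z)).mdifferentiableAt
    (by norm_num)).hasMFDerivAt
  have h3 := ((Total.contMDiff_pt (π.dualCharts k) z).mdifferentiableAt (by norm_num)).hasMFDerivAt
  have h4 : (Total.pt ∘ h : π.DualJet k → Y) = Total.pt := funext hh.pt_apply
  have h5 := h2.comp z h1
  rw [h4] at h5
  exact DFunLike.congr_fun (hasMFDerivAt_unique h5 h3) V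

/-- In induced coordinates, `Θ_h` is given by the coordinates of `h`. -/
theorem IsHamiltonian.inChart_hamiltonCartan {k : ℕ} {h : π.DualJet k → π.FormBundle k 2}
    (hh : π.IsHamiltonian h) {z₀ z : π.DualJet k}
    (hz : z.pt ∈ (π.adaptedAt z₀.pt).1.1.source)
    (v : Fin k → (E × F) × SemiFormsQuot (modelVertical E F) k) :
    (π.hamiltonCartan h).inChart z₀ (extChartAt (π.dualModel k) z₀ z) v =
      ((π.formCharts k 2).coord (π.adaptedAt z₀.pt) (h z)).1 (fun i => (v i).1) := by
  have hz' : (h z).pt ∈ (π.adaptedAt z₀.pt).1.1.source := by rwa [hh.pt_apply]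
  rw [DForm.inChart_apply, (extChartAt (π.dualModel k) z₀).left_inv
    ((Total.mem_extChartAt_source (π.dualCharts k)).2 hz),
    FibreCharts.coord_of_mem (π.formCharts k 2) (π.adaptedAt z₀.pt) (h z) hz']
  change (h z).fib.1 (fun i => tangentMapAt (π.formModel k 2) (I.prod 𝓘(ℝ, F)) Total.pt (h z)
    (tangentMapAt (π.dualModel k) (π.formModel k 2) h z
      (chartFrame (π.dualModel k) z₀ (extChartAt (π.dualModel k) z₀ z) (v i)))) =
    (h z).fib.1 (fun i => tangentMapAt (I.prod 𝓘(ℝ, F)) (I.prod 𝓘(ℝ, F))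
      (π.adaptedAt z₀.pt).1.1.symm ((π.adaptedAt z₀.pt).1.1 (h z).pt) (v i).1)
  congr 1
  funext i
  rw [hh.tangentMapAt_pt, hh.pt_apply]
  have h1 := Total.tangentMapAt_base_pt_chartFrame (π.dualCharts k) hz (v i)
  rw [← h1]
  exact (tangentMapAt_symm_chart (π.adaptedAt z₀.pt).2.mem_total hz _).symm

/-- On fixed vectors, the coordinate expression of `Θ_h` is a fixed linear functional of the fibre
coordinates of `h`. -/
theorem IsHamiltonian.isSmooth_hamiltonCartan {k : ℕ} {h : π.DualJet k → π.FormBundle k 2}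
    (hh : π.IsHamiltonian h) : (π.hamiltonCartan h).IsSmooth := by
  intro z₀
  refine contDiffOn_alternating_of_apply fun v => ?_
  have h1 : ContMDiffOn (π.formModel k 2) 𝓘(ℝ, (E × F) × semiForms (modelVertical E F) k 2) ∞
      (extChartAt (π.formModel k 2) (h z₀)) (chartAt _ (h z₀)).source := contMDiffOn_extChartAt
  have h2 := contMDiffOn_extChartAt_symm (I := π.dualModel k) (n := ∞) z₀
  have h3 := (h1.comp (hh.smooth.comp_contMDiffOn h2) (by
    intro e he
    have hz := (Total.mem_extChartAt_source (π.dualCharts k)).1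
      ((extChartAt (π.dualModel k) z₀).map_target he)
    -- Since `h` preserves the point of `Y`, the charts at `z₀` and at `h z₀` are induced by the
    -- same adapted pair.
    change (h _).pt ∈ (π.adaptedAt (h z₀).pt).1.1.source
    rw [hh.pt_apply, hh.pt_apply]
    exact hz)).contDiffOn
  have h4 := (contDiff_evalCLM (fun i => (v i).1)).comp_contDiffOn
    ((semiForms (modelVertical E F) k 2).subtypeL.contDiff.comp_contDiffOn
      (contDiff_snd.comp_contDiffOn h3))
  refine h4.congr fun e he => ?_
  obtain ⟨z, hz, rfl⟩ : ∃ z, z ∈ (extChartAt (π.dualModel k) z₀).source ∧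
      extChartAt (π.dualModel k) z₀ z = e :=
    ⟨_, (extChartAt (π.dualModel k) z₀).map_target he, (extChartAt (π.dualModel k) z₀).right_inv he⟩
  rw [hh.inChart_hamiltonCartan ((Total.mem_extChartAt_source (π.dualCharts k)).1 hz)]
  change _ = ((π.formCharts k 2).coord (π.adaptedAt (h z₀).pt)
    (h ((extChartAt (π.dualModel k) z₀).symm (extChartAt (π.dualModel k) z₀ z)))).1 _
  rw [(extChartAt (π.dualModel k) z₀).left_inv hz, hh.pt_apply]

end Fibration
end Hamiltonian

/-! ### Coordinate expression and smoothness of `Θ_L` -/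

section PoincareCartan

variable {E : Type*} [NormedAddCommGroup E] [NormedSpace ℝ E] [FiniteDimensional ℝ E]
  {H : Type*} [TopologicalSpace H] {I : ModelWithCorners ℝ E H}
  {F : Type*} [NormedAddCommGroup F] [NormedSpace ℝ F] [FiniteDimensional ℝ F]
  {X : Type*} [TopologicalSpace X] [ChartedSpace H X]
  {Y : Type*} [TopologicalSpace Y] [ChartedSpace (ModelProd H F) Y]

/-- The coordinate expression of `(dy^i - z^i_μ dx^μ) ∧ d^n x_ν`, for a volume form `g` on `E` and
a jet with coordinates `A`. -/
def contactWedge {n : ℕ} (g : E [⋀^Fin (n + 1)]→L[ℝ] ℝ) (A : E →L[ℝ] F)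
    (v : Fin (n + 1) → (E × F) × (E →L[ℝ] F)) : E →L[ℝ] F :=
  ∑ j : Fin (n + 1), (-1 : ℤ) ^ (j : ℕ) •
    (g.curryLeft.flipAlternating (fun l => (j.removeNth v l).1.1)).smulRight
      ((v j).1.2 - A (v j).1.1)

theorem contactWedge_apply {n : ℕ} (g : E [⋀^Fin (n + 1)]→L[ℝ] ℝ) (A : E →L[ℝ] F)
    (v : Fin (n + 1) → (E × F) × (E →L[ℝ] F)) (u : E) :
    contactWedge g A v u = ∑ j : Fin (n + 1), (-1 : ℤ) ^ (j : ℕ) •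
      g (Matrix.vecCons u (fun l => (j.removeNth v l).1.1)) • ((v j).1.2 - A (v j).1.1) := by
  simp [contactWedge]

theorem contDiffOn_contactWedge {P : Type*} [NormedAddCommGroup P] [NormedSpace ℝ P] {t : Set P}
    {n : ℕ} {g : P → E [⋀^Fin (n + 1)]→L[ℝ] ℝ} {A : P → E →L[ℝ] F}
    (hg : ContDiffOn ℝ ∞ g t) (hA : ContDiffOn ℝ ∞ A t)
    (v : Fin (n + 1) → (E × F) × (E →L[ℝ] F)) :
    ContDiffOn ℝ ∞ (fun p => contactWedge (g p) (A p) v) t := by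
  refine contDiffOn_clm_apply.2 fun u => ?_
  simp only [contactWedge_apply, ← Int.cast_smul_eq_zsmul ℝ]
  refine ContDiffOn.sum fun j _ => contDiffOn_const.smul ?_
  exact ((contDiff_evalCLM _).comp_contDiffOn hg).smul
    (contDiffOn_const.sub (hA.clm_apply contDiffOn_const))

/-- The tangent map at `0` of a map that is affine in a chart. -/
theorem tangentMapAt_zero_of_extChartAt_eq {V : Type*} [NormedAddCommGroup V] [NormedSpace ℝ V]
    {E : Type*} [NormedAddCommGroup E] [NormedSpace ℝ E] {H : Type*} [TopologicalSpace H]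
    {I : ModelWithCorners ℝ E H} {M : Type*} [TopologicalSpace M] [ChartedSpace H M]
    [IsManifold I ∞ M] {x₀ : M} {τ : V → M} {e : E} {A : V →L[ℝ] E}
    (hsource : ∀ f, τ f ∈ (extChartAt I x₀).source)
    (hτ : ∀ f, extChartAt I x₀ (τ f) = e + A f) (f : V) :
    tangentMapAt 𝓘(ℝ, V) I τ 0 f = chartFrame I x₀ e (A f) := by
  have hmem : ∀ f, e + A f ∈ (extChartAt I x₀).target := fun f =>
    hτ f ▸ (extChartAt I x₀).map_source (hsource f)
  have h1 : HasFDerivAt (fun f => e + A f) A 0 := A.hasFDerivAt.const_add e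
  have h2 := (mdifferentiableWithinAt_extChartAt_symm (hmem 0)).hasMFDerivWithinAt
  -- The whole affine image stays in the chart target, so the derivative of the inverse chart within
  -- `range I` yields an unrestricted derivative of `τ`, even over the boundary.
  have h2' : univ ⊆ (fun f => e + A f) ⁻¹' range I := fun f _ =>
    extChartAt_target_subset_range x₀ (hmem f)
  have h3 := h2.comp (0 : V) (s := univ) h1.hasMFDerivAt.hasMFDerivWithinAt h2'
  have h4 : ((extChartAt I x₀).symm ∘ fun f => e + A f) = τ := by
    funext f
    rw [Function.comp_apply, ← hτ, (extChartAt I x₀).left_inv (hsource f)]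
  rw [h4] at h3
  refine Eq.trans (DFunLike.congr_fun (hasMFDerivWithinAt_univ.1 h3).mfderiv f) ?_
  change chartFrame I x₀ (e + A 0) (A f) = _
  rw [map_zero, add_zero]

namespace Fibration

variable {π : Fibration I F X Y} [IsManifold I ∞ X] [IsManifold (I.prod 𝓘(ℝ, F)) ∞ Y]

theorem tangentMapAt_jetProj (z : π.Jet) :
    tangentMapAt π.jetModel I π.jetProj z = (π.tangentProj z.pt).comp (π.tangentJet z) := by
  have h1 := ((Total.contMDiff_pt π.jetCharts z).mdifferentiableAt (by norm_num)).hasMFDerivAt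
  have h2 := ((contMDiffAt_proj (π := π) z.pt).mdifferentiableAt (by norm_num)).hasMFDerivAt
  exact (h2.comp z h1).mfderiv

variable {z₀ z : π.Jet}

theorem tangentMapAt_tangentJet (hz : z.pt ∈ (π.adaptedAt z₀.pt).1.1.source)
    (v : (E × F) × (E →L[ℝ] F)) :
    tangentMapAt (I.prod 𝓘(ℝ, F)) (I.prod 𝓘(ℝ, F)) (π.adaptedAt z₀.pt).1.1 z.pt
      (π.tangentJet z (chartFrame π.jetModel z₀ (extChartAt π.jetModel z₀ z) v)) = v.1 :=
  Total.tangentMapAt_base_pt_chartFrame π.jetCharts hz v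

theorem tangentMapAt_tangentProj_tangentJet (hz : z.pt ∈ (π.adaptedAt z₀.pt).1.1.source)
    (v : (E × F) × (E →L[ℝ] F)) :
    tangentMapAt I I (π.adaptedAt z₀.pt).1.2 (π.proj z.pt) (π.tangentProj z.pt
      (π.tangentJet z (chartFrame π.jetModel z₀ (extChartAt π.jetModel z₀ z) v))) = v.1.1 := by
  rw [← fst_tangentMapAt (π.adaptedAt z₀.pt) hz, tangentMapAt_tangentJet hz]

/-- Only the `x`-component of a coordinate vector survives in `T_x X`. This puts the arguments of
`η` in the form required by its expression in the adapted base chart. -/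
theorem tangentProj_tangentJet (hz : z.pt ∈ (π.adaptedAt z₀.pt).1.1.source)
    (v : (E × F) × (E →L[ℝ] F)) :
    π.tangentProj z.pt
      (π.tangentJet z (chartFrame π.jetModel z₀ (extChartAt π.jetModel z₀ z) v)) =
    tangentMapAt I I (π.adaptedAt z₀.pt).1.2.symm
      ((π.adaptedAt z₀.pt).1.2 (π.proj z.pt)) v.1.1 := by
  rw [← tangentMapAt_tangentProj_tangentJet hz v,
    tangentMapAt_symm_chart (π.adaptedAt z₀.pt).2.mem_base
      ((π.adaptedAt z₀.pt).2.mapsTo _ hz)]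

/-- The contact forms in coordinates. -/
theorem tangentMapAt_contact (hz : z.pt ∈ (π.adaptedAt z₀.pt).1.1.source)
    (v : (E × F) × (E →L[ℝ] F)) :
    (tangentMapAt (I.prod 𝓘(ℝ, F)) (I.prod 𝓘(ℝ, F)) (π.adaptedAt z₀.pt).1.1 z.pt
      (π.contact z (chartFrame π.jetModel z₀ (extChartAt π.jetModel z₀ z) v))).2 =
    v.1.2 - π.jetCharts.coord (π.adaptedAt z₀.pt) z v.1.1 := by
  rw [FibreCharts.coord_of_mem π.jetCharts (π.adaptedAt z₀.pt) z hz]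
  have h := π.jetTriv_apply (π.adaptedAt z₀.pt) z.pt hz z.fib (π.tangentProj z.pt
      (π.tangentJet z (chartFrame π.jetModel z₀ (extChartAt π.jetModel z₀ z) v)))
  rw [tangentMapAt_tangentProj_tangentJet hz] at h
  change (tangentMapAt (I.prod 𝓘(ℝ, F)) (I.prod 𝓘(ℝ, F)) (π.adaptedAt z₀.pt).1.1 z.pt
    (π.tangentJet z _ - z.fib.1 (π.tangentProj z.pt (π.tangentJet z _)))).2 =
      v.1.2 - π.jetTriv (π.adaptedAt z₀.pt) z.pt hz z.fib v.1.1
  rw [map_sub, Prod.snd_sub, tangentMapAt_tangentJet hz, h]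

/-- The translation of jets in coordinates. -/
def translateCoord (z₀ z : π.Jet) : (E →L[ℝ] π.vertical z.pt) →L[ℝ] (E →L[ℝ] F) :=
  (ContinuousLinearMap.compL ℝ E (π.vertical z.pt) F
    (((ContinuousLinearMap.snd ℝ E F).comp
      (tangentMapAt (I.prod 𝓘(ℝ, F)) (I.prod 𝓘(ℝ, F)) (π.adaptedAt z₀.pt).1.1 z.pt)).comp
        (π.vertical z.pt).subtypeL)).comp
    ((ContinuousLinearMap.compL ℝ E E (π.vertical z.pt)).flip
      (tangentMapAt I I (π.adaptedAt z₀.pt).1.2.symm ((π.adaptedAt z₀.pt).1.2 (π.proj z.pt))))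

theorem translateCoord_apply (z₀ z : π.Jet) (f : E →L[ℝ] π.vertical z.pt) (u : E) :
    translateCoord z₀ z f u =
      (tangentMapAt (I.prod 𝓘(ℝ, F)) (I.prod 𝓘(ℝ, F)) (π.adaptedAt z₀.pt).1.1 z.pt
        (f (tangentMapAt I I (π.adaptedAt z₀.pt).1.2.symm
          ((π.adaptedAt z₀.pt).1.2 (π.proj z.pt)) u) : E × F)).2 := rfl

/-- The fibre coordinates of a jet depend linearly on its underlying map `T_x X → T_y Y`, and a
translation does not move `y`; hence it is affine in the chart, and its derivative, the vertical
lift, can be read off. -/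
theorem extChartAt_translate (hz : z.pt ∈ (π.adaptedAt z₀.pt).1.1.source)
    (f : E →L[ℝ] π.vertical z.pt) :
    extChartAt π.jetModel z₀ (π.translate z f) =
      extChartAt π.jetModel z₀ z + (0, translateCoord z₀ z f) := by
  rw [Total.extChartAt_apply, Total.extChartAt_apply]
  refine Prod.ext (add_zero _).symm ?_
  change π.jetCharts.coord (π.adaptedAt z₀.pt) (π.translate z f) =
    π.jetCharts.coord (π.adaptedAt z₀.pt) z + translateCoord z₀ z f
  rw [FibreCharts.coord_of_mem π.jetCharts (π.adaptedAt z₀.pt) z hz,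
    FibreCharts.coord_of_mem π.jetCharts (π.adaptedAt z₀.pt) (π.translate z f) hz]
  ext u
  rw [add_apply, translateCoord_apply]
  change (tangentMapAt (I.prod 𝓘(ℝ, F)) (I.prod 𝓘(ℝ, F)) (π.adaptedAt z₀.pt).1.1 z.pt
    (z.fib.1 _ + (f _ : E × F))).2 = _
  rw [map_add, Prod.snd_add]
  rfl

/-- The vertical lift in coordinates. -/
theorem verticalLift_eq (hz : z.pt ∈ (π.adaptedAt z₀.pt).1.1.source)
    (f : E →L[ℝ] π.vertical z.pt) :
    π.verticalLift z f = chartFrame π.jetModel z₀ (extChartAt π.jetModel z₀ z)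
      (0, translateCoord z₀ z f) := by
  exact tangentMapAt_zero_of_extChartAt_eq (V := E →L[ℝ] π.vertical z.pt) (I := π.jetModel)
    (x₀ := z₀) (τ := π.translate z) (e := extChartAt π.jetModel z₀ z)
    (A := (0 : (E →L[ℝ] π.vertical z.pt) →L[ℝ] E × F).prod (translateCoord z₀ z))
    (fun f => (Total.mem_extChartAt_source π.jetCharts).2 hz) (extChartAt_translate hz) f

/-- The derivative of a function in coordinates. -/
theorem _root_.FieldTheory.tangentMapAt_chartFrame_eq_fderivWithin
    {E : Type*} [NormedAddCommGroup E] [NormedSpace ℝ E] {H : Type*} [TopologicalSpace H]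
    {I : ModelWithCorners ℝ E H} {M : Type*} [TopologicalSpace M] [ChartedSpace H M]
    [IsManifold I ∞ M] {L : M → ℝ} (hL : ContMDiff I 𝓘(ℝ, ℝ) ∞ L) {x₀ x : M}
    (hx : x ∈ (extChartAt I x₀).source) (u : E) :
    tangentMapAt I 𝓘(ℝ, ℝ) L x (chartFrame I x₀ (extChartAt I x₀ x) u) =
      fderivWithin ℝ (L ∘ (extChartAt I x₀).symm) (range I) (extChartAt I x₀ x) u := by
  have hx' := (extChartAt I x₀).map_source hx
  have h1 := (mdifferentiableWithinAt_extChartAt_symm hx').hasMFDerivWithinAt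
  have h2 : HasMFDerivAt I 𝓘(ℝ, ℝ) L ((extChartAt I x₀).symm (extChartAt I x₀ x))
      (tangentMapAt I 𝓘(ℝ, ℝ) L x) := by
    rw [(extChartAt I x₀).left_inv hx]
    exact ((hL x).mdifferentiableAt (by norm_num)).hasMFDerivAt
  have h3 : HasFDerivWithinAt (L ∘ (extChartAt I x₀).symm)
      ((tangentMapAt I 𝓘(ℝ, ℝ) L x).comp (chartFrame I x₀ (extChartAt I x₀ x))) (range I)
      (extChartAt I x₀ x) :=
    hasMFDerivWithinAt_iff_hasFDerivWithinAt.1 (h2.comp_hasMFDerivWithinAt _ h1)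
  rw [h3.fderivWithin (I.uniqueDiffOn _ (extChartAt_target_subset_range x₀ hx'))]
  rfl

/-- The Poincaré-Cartan form in coordinates. -/
theorem inChart_poincareCartan (hz : z.pt ∈ (π.adaptedAt z₀.pt).1.1.source) {n : ℕ}
    (η : DForm I X (n + 1)) {L : π.Jet → ℝ}
    (hL : ContMDiff π.jetModel 𝓘(ℝ, ℝ) ∞ L) (v : Fin (n + 1) → (E × F) × (E →L[ℝ] F)) :
    (π.poincareCartan η L).inChart z₀ (extChartAt π.jetModel z₀ z) v =
      (L ∘ (extChartAt π.jetModel z₀).symm) (extChartAt π.jetModel z₀ z) *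
        η.inAtlasChart (π.adaptedAt z₀.pt).1.2 (extChartAt π.jetModel z₀ z).1.1
          (fun l => (v l).1.1) +
      fderivWithin ℝ (L ∘ (extChartAt π.jetModel z₀).symm) (range π.jetModel)
        (extChartAt π.jetModel z₀ z)
        (0, contactWedge
          (η.inAtlasChart (π.adaptedAt z₀.pt).1.2 (extChartAt π.jetModel z₀ z).1.1)
          (extChartAt π.jetModel z₀ z).2 v) := by
  have hz' : z ∈ (extChartAt π.jetModel z₀).source :=
    (Total.mem_extChartAt_source π.jetCharts).2 hz
  have hx := (π.adaptedAt z₀.pt).2.mapsTo _ hz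
  -- In adapted charts the first coordinate of a point of `Y` is the base coordinate of its
  -- projection, so `η` is evaluated at the right point.
  have he : (extChartAt π.jetModel z₀ z).1.1 = I ((π.adaptedAt z₀.pt).1.2 (π.proj z.pt)) := by
    rw [← (π.adaptedAt z₀.pt).2.fst_eq _ hz]
    rfl
  rw [DForm.inChart_apply, Function.comp_apply, (extChartAt π.jetModel z₀).left_inv hz']
  change L z * η (π.proj z.pt) (fun l => tangentMapAt π.jetModel I π.jetProj z
      (chartFrame π.jetModel z₀ (extChartAt π.jetModel z₀ z) (v l))) +
    tangentMapAt π.jetModel 𝓘(ℝ, ℝ) L z (π.verticalLift z (wedgeOne (π.contact z)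
      (π.volumeContraction η z) (fun l =>
        chartFrame π.jetModel z₀ (extChartAt π.jetModel z₀ z) (v l)))) = _
  rw [verticalLift_eq hz, tangentMapAt_chartFrame_eq_fderivWithin hL hz', he,
    η.inAtlasChart_apply hx]
  congr 2
  · congr 2
    funext l
    rw [tangentMapAt_jetProj]
    exact tangentProj_tangentJet hz (v l)
  · congr 2
    ext u
    rw [translateCoord_apply, wedgeOne_apply, contactWedge_apply]
    -- `T` reads the fibre coordinates of a vertical vector. Being linear, it passes through the
    -- alternating sum, leaving two factors to compare in each summand: the contraction of `η` and
    -- the contact form.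
    set T : π.vertical z.pt →L[ℝ] F := ((ContinuousLinearMap.snd ℝ E F).comp
      (tangentMapAt (I.prod 𝓘(ℝ, F)) (I.prod 𝓘(ℝ, F)) (π.adaptedAt z₀.pt).1.1 z.pt)).comp
        (π.vertical z.pt).subtypeL
    change T (∑ j : Fin (n + 1), _) = _
    rw [map_sum]
    refine Finset.sum_congr rfl fun j _ => ?_
    rw [map_zsmul, map_smul]
    congr 2
    · rw [η.inAtlasChart_apply hx]
      change η (π.proj z.pt) _ = η (π.proj z.pt) _
      congr 1
      funext l
      refine Fin.cases rfl (fun l => ?_) l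
      exact tangentProj_tangentJet hz (j.removeNth v l)
    · exact tangentMapAt_contact hz (v j)

/-- On fixed vectors, the coordinate expression is the sum of `L` times a coefficient of `η` and the
fibre derivative of `L` applied to `contactWedge`; every ingredient is smooth in the jet
coordinates. -/
theorem isSmooth_poincareCartan {n : ℕ} {η : DForm I X (n + 1)} (hη : η.IsSmooth) {L : π.Jet → ℝ}
    (hL : ContMDiff π.jetModel 𝓘(ℝ, ℝ) ∞ L) : (π.poincareCartan η L).IsSmooth := by
  intro z₀
  have hLc : ContDiffOn ℝ ∞ (L ∘ (extChartAt π.jetModel z₀).symm)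
      (extChartAt π.jetModel z₀).target :=
    (hL.comp_contMDiffOn (contMDiffOn_extChartAt_symm (n := ∞) z₀)).contDiffOn
  have hpt : ∀ e ∈ (extChartAt π.jetModel z₀).target, ∃ z : π.Jet,
      z.pt ∈ (π.adaptedAt z₀.pt).1.1.source ∧ extChartAt π.jetModel z₀ z = e := fun e he =>
    ⟨_, (Total.mem_extChartAt_source π.jetCharts).1 ((extChartAt π.jetModel z₀).map_target he),
      (extChartAt π.jetModel z₀).right_inv he⟩
  have hηc : ContDiffOn ℝ ∞ (fun e : (E × F) × (E →L[ℝ] F) =>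
      η.inAtlasChart (π.adaptedAt z₀.pt).1.2 e.1.1) (extChartAt π.jetModel z₀).target := by
    -- The coefficients of `η` depend on the base coordinates alone, so they are composed with the
    -- projection to `x`, whose values must lie in the domain of the base chart.
    refine (hη.contDiffOn_inAtlasChart (π.adaptedAt z₀.pt).2.mem_base).comp
      (contDiff_fst.comp contDiff_fst).contDiffOn fun e he => ?_
    obtain ⟨z, hz, rfl⟩ := hpt e he
    have h : (extChartAt π.jetModel z₀ z).1.1 = I ((π.adaptedAt z₀.pt).1.2 (π.proj z.pt)) := by
      rw [← (π.adaptedAt z₀.pt).2.fst_eq _ hz]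
      rfl
    change (extChartAt π.jetModel z₀ z).1.1 ∈ _
    rw [h]
    refine ⟨?_, mem_range_self _⟩
    rw [mem_preimage, I.left_inv]
    exact (π.adaptedAt z₀.pt).1.2.map_source ((π.adaptedAt z₀.pt).2.mapsTo _ hz)
  refine contDiffOn_alternating_of_apply fun v => ?_
  refine ((hLc.mul ((contDiff_evalCLM (fun l => (v l).1.1)).comp_contDiffOn hηc)).add
    ((contDiffOn_fderivWithin_range hLc).clm_apply ((contDiffOn_const (c := 0)).prodMk
      (contDiffOn_contactWedge hηc contDiff_snd.contDiffOn v)))).congr fun e he => ?_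
  obtain ⟨z, hz, rfl⟩ := hpt e he
  exact inChart_poincareCartan hz η hL v

end Fibration
end PoincareCartan

end FieldTheory

end

theorem mainTheorem2 {n : ℕ}
    {E : Type*} [NormedAddCommGroup E] [NormedSpace ℝ E] [FiniteDimensional ℝ E]
    {H : Type*} [TopologicalSpace H] {I : ModelWithCorners ℝ E H}
    {F : Type*} [NormedAddCommGroup F] [NormedSpace ℝ F] [FiniteDimensional ℝ F]
    {X : Type*} [TopologicalSpace X] [ChartedSpace H X] [IsManifold I ∞ X]
    {Y : Type*} [TopologicalSpace Y] [ChartedSpace (ModelProd H F) Y]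
    [IsManifold (I.prod 𝓘(ℝ, F)) ∞ Y]
    (π : Fibration I F X Y)
    (η : DForm I X (n + 1)) (hη : η.IsVolumeForm)
    {EB : Type*} [NormedAddCommGroup EB] [NormedSpace ℝ EB] [FiniteDimensional ℝ EB]
    {HB : Type*} [TopologicalSpace HB] {IB : ModelWithCorners ℝ EB HB}
    {B : Type*} [TopologicalSpace B] [ChartedSpace HB B] [IsManifold IB ∞ B] :
    (∀ (L : π.Jet → ℝ), ContMDiff π.jetModel 𝓘(ℝ, ℝ) ∞ L →
      ∀ (bc : BoundaryCondition I π.jetProj (π.poincareCartan η L) IB B)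
        (ξ : VField π.jetModel π.Jet) (α : DForm π.jetModel π.Jet n),
        IsCartanSymmetry bc ξ α →
          IsPreservedQuantity I π.jetProj (π.poincareCartan η L)
            ((π.poincareCartan η L).interior ξ - α) ∧
          (DForm.pullback (I := IB) bc.incl
            ((π.poincareCartan η L).interior ξ - α)).IsExact) ∧
    (∀ h : π.DualJet (n + 1) → π.FormBundle (n + 1) 2, π.IsHamiltonian h →
      ∀ (bc : BoundaryCondition I (π.dualProj (n + 1)) (π.hamiltonCartan h) IB B)
        (ξ : VField (π.dualModel (n + 1)) (π.DualJet (n + 1)))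
        (α : DForm (π.dualModel (n + 1)) (π.DualJet (n + 1)) n),
        IsCartanSymmetry bc ξ α →
          IsPreservedQuantity I (π.dualProj (n + 1)) (π.hamiltonCartan h)
            ((π.hamiltonCartan h).interior ξ - α) ∧
          (DForm.pullback (I := IB) bc.incl
            ((π.hamiltonCartan h).interior ξ - α)).IsExact) := by
  -- Given the smoothness of `Θ_L` and `Θ_h`, both halves are the general theorem, applied to the
  -- jet bundle and to the dual jet bundle.
  refine ⟨fun L hL bc ξ α h => ?_, fun h hh bc ξ α hξ => ?_⟩
  · exact ⟨h.isPreservedQuantity (Fibration.isSmooth_poincareCartan hη.smooth hL), h.isExact⟩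
  · exact ⟨hξ.isPreservedQuantity hh.isSmooth_hamiltonCartan, hξ.isExact⟩
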